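/- **Theorem 10.3.** Let $q\in L^\infty((0,\infty))$ be real-valued. A *Weyl solution* at $z\in\mathbb C$ is a solution $u=u(\cdot,z)\not\equiv 0$ of $-u''+qu=zu$ on $[0,\infty)$ ($u$ and $u'$ locally absolutely continuous, the equation holding almost everywhere) with $\int_0^\infty|u(x)|^2\,dx<\infty$. The principal Weyl–Titchmarsh function of $-\frac{d^2}{dx^2}+q$ in $L^2((0,\infty))$ is $m(z)=u'(0_+,z)/u(0_+,z)$, with $u(\cdot,z)$ a Weyl solution. An $A$-amplitude of $q$ is a real-valued function $A$ on $(0,\infty)$ with $A\in L^1((0,a))$ for all $a>0$ such that, for all $a>0$ and $\varepsilon>0$, $$m(-\kappa^2)=-\kappa-\int_0^a A(\alpha)e^{-2\alpha\kappa}\,d\alpha+\tilde O(e^{-2a\kappa})$$ as $|\kappa|\to\infty$ with $-\frac{\pi}{2}+\varepsilon<\arg(\kappa)<-\varepsilon$, where $f=\tilde O(g)$ means that $g\to0$ and $(f/g)|g|^{\delta}\to0$ for all $\delta>0$. Then $q$ has an $A$-amplitude. Moreover, for every $A$-amplitude $A$ of $q$ and every real $\kappa>0$ with $\kappa^2>\|q\|_\infty$: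 a Weyl solution at $-\kappa^2$ exists, every such solution satisfies $u(0_+)\neq0$ and has the same quotient $u'(0_+)/u(0_+)=m(-\kappa^2)$, the function $m$ is analytic at $-\kappa^2$ (so that $m(-\kappa^2)$ is the value of the analytic continuation of $m$ from the upper half plane), the integral $\int_0^\infty A(\alpha)e^{-2\alpha\kappa}\,d\alpha$ converges absolutely, and $$m(-\kappa^2)=-\kappa-\int_0^\infty A(\alpha)e^{-2\alpha\kappa}\,d\alpha,$$ with no error term. -/

import Mathlib

open Set Filter Topology MeasureTheory

noncomputable section

namespace Schrodinger

/-- `u`, with derivative `u'`, is a Weyl solution on the half-line `[0, ∞)` at the energy `z`: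
a solution of `-u'' + q u = z u` that is not identically zero and is square integrable at infinity.
Here `u` is differentiable on `[0, ∞)` (one-sided at `0`) and `u'` is locally absolutely
continuous with `(u')' = (q - z) u` almost everywhere, written in integrated form (the potential
`q` is supposed to be locally integrable on `[0, ∞)`).
Values of `u`, `u'`, `q` on `(-∞, 0)` play no role. -/
structure IsWeylSolution (q : ℝ → ℝ) (z : ℂ) (u u' : ℝ → ℂ) : Prop where
  hasDeriv : ∀ x ∈ Ici (0 : ℝ), HasDerivWithinAt u (u' x) (Ici 0) x
  equation : ∀ x ∈ Ici (0 : ℝ), u' x = u' 0 + ∫ t in (0 : ℝ)..x, ((q t : ℂ) - z) * u t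
  nonzero : ∃ x ∈ Ici (0 : ℝ), u x ≠ 0
  memLp : MemLp u 2 (volume.restrict (Ioi (0 : ℝ)))

open Classical in
/-- The principal Weyl-Titchmarsh function `m(z) = u'(0₊, z) / u(0₊, z)` of `-d²/dx² + q` in
`L²((0, ∞))`, where `u(·, z)` is a Weyl solution at `z`, for `q` in the limit point case at
infinity. In that case the Weyl solution is unique up to a factor, so that the choice of it does not
matter. (Where there is no Weyl solution the value is `0` by convention.) -/
def weylM (q : ℝ → ℝ) (z : ℂ) : ℂ :=
  if h : ∃ p : (ℝ → ℂ) × (ℝ → ℂ), IsWeylSolution q z p.1 p.2 then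
    h.choose.2 0 / h.choose.1 0
  else 0

/-- `f = Õ(g)` along the filter `l`: `g → 0`, and `(f / g) |g| ^ ε → 0` for all `ε > 0`. -/
def IsOTilde (l : Filter ℂ) (f g : ℂ → ℂ) : Prop :=
  Tendsto g l (𝓝 0) ∧
    ∀ ε : ℝ, 0 < ε → Tendsto (fun κ => f κ / g κ * ((‖g κ‖ ^ ε : ℝ) : ℂ)) l (𝓝 0)

/-- The filter of `|κ| → ∞` in the sector `-π/2 + ε < arg κ < -ε`. For these `κ` the point `-κ²`
lies in the upper half plane. -/
def sectorAtInfinity (ε : ℝ) : Filter ℂ :=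
  Bornology.cobounded ℂ ⊓ 𝓟 {κ : ℂ | -(Real.pi / 2) + ε < κ.arg ∧ κ.arg < -ε}

/-- `A` is the `A`-amplitude of the potential `q` on `(0, ∞)`: it is integrable on every bounded
interval `(0, a)`, and for all `a > 0` and `ε > 0`
`m(-κ²) = -κ - ∫₀ᵃ A(α) e^{-2ακ} dα + Õ(e^{-2aκ})`
as `|κ| → ∞` in the sector `-π/2 + ε < arg κ < -ε`. These properties determine `A` almost
everywhere. -/
structure IsAAmplitude (q : ℝ → ℝ) (A : ℝ → ℝ) : Prop where
  integrable : ∀ a : ℝ, 0 < a → IntegrableOn A (Ioo 0 a)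
  asymptotics : ∀ a : ℝ, 0 < a → ∀ ε : ℝ, 0 < ε →
    IsOTilde (sectorAtInfinity ε)
      (fun κ => weylM q (-κ ^ 2) -
        (-κ - ∫ α in (0 : ℝ)..a, (A α : ℂ) * Complex.exp (-2 * (α : ℂ) * κ)))
      (fun κ => Complex.exp (-2 * (a : ℂ) * κ))

end Schrodinger

end

noncomputable section

namespace Schrodinger

open scoped ENNReal

/-! With `z = -κ²` and `m = -κ - n`, the Riccati equation for the logarithmic derivative of a Weyl
solution becomes `n' = 2κn + n² - q`. If `n(κ, x)` is the Laplace transform of `A(·, x)` at `2κ`,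
this says `∂A/∂x = ∂A/∂α + A * A` with `A(0, x) = q(x)`. The argument runs this backwards: it
constructs `A(α, x)` by Picard iteration, transforms it, and recovers the Weyl solution as `exp(-κx
- ∫ n)`.

The sharp range `κ² > ‖q‖_∞` comes from a majorant. With `q` replaced by its bound `Q` and the minus
sign by a plus, the weighted integrals of the iterates stay below the small root `a - √(a² - Q)` of
`2an = Q + n²`, real exactly when `Q ≤ a²` (`lintegral_expWeight_majIter_le`). Increments of the
iterates are dominated by increments of the majorants (`enorm_ampIter_sub_add_le`), so the iterates
converge and dominated convergence gives the integrated Riccati equation (`riccati_eq`). Since `|n|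
≤ a - √(a² - Q) < a = Re κ`, the solution `exp(-κx - ∫ n)` decays exponentially and is a Weyl
solution. A Wronskian argument shows that every other one is proportional to it, so `m(-κ²) = -κ -
n(κ, 0)` with no error term (`weylM_eq`). Truncating the Laplace integral at `a` shows that `A(·,
0)` is an amplitude; differentiating under the integral gives analyticity.

An arbitrary amplitude is then compared with this one. The difference over `(0, b)` has a Laplace
transform of size `e^{-2b Re κ}` on one ray; by Phragmén–Lindelöf and Liouville it vanishes
(`laplace_eq_zero_of_bound`). So all amplitudes agree almost everywhere (`IsAAmplitude.ae_eq`) and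
inherit the formula. -/

/-! ### Picard iterates and their majorants -/

/-- One step of the Picard iteration for the integrated form of
`∂A/∂x = ∂A/∂α + ∫₀^α A(β, x) A(α - β, x) dβ`, `A(0, x) = q(x)`. -/
def picardStep (q : ℝ → ℝ) (B : ℝ → ℝ → ℝ) (α x : ℝ) : ℝ :=
  (if 0 < α then q (x + α) else 0) -
    ∫ p : ℝ × ℝ, if 0 < p.1 then B p.2 (x + p.1) * B (α - p.1 - p.2) (x + p.1) else 0

/-- The Picard iterates for the `x`-dependent `A`-amplitude `A(α, x)`. -/
def ampIter (q : ℝ → ℝ) : ℕ → ℝ → ℝ → ℝ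
  | 0 => fun _ _ => 0
  | k + 1 => picardStep q (ampIter q k)

/-- The majorants of the Picard iterates, obtained from a bound `Q` of the potential. -/
def majIter (Q : ℝ≥0∞) : ℕ → ℝ → ℝ≥0∞
  | 0 => fun _ => 0
  | k + 1 => fun α => (if 0 < α then Q else 0) +
      ∫⁻ p : ℝ × ℝ, if 0 < p.1 then majIter Q k p.2 * majIter Q k (α - p.1 - p.2) else 0

lemma measurable_picardIntegrand {B : ℝ → ℝ → ℝ} (hB : Measurable (Function.uncurry B)) :
    Measurable fun r : (ℝ × ℝ) × (ℝ × ℝ) => if 0 < r.2.1 then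
      B r.2.2 (r.1.2 + r.2.1) * B (r.1.1 - r.2.1 - r.2.2) (r.1.2 + r.2.1) else 0 := by
  have h1 : Measurable fun r : (ℝ × ℝ) × (ℝ × ℝ) => B r.2.2 (r.1.2 + r.2.1) :=
    hB.comp (by fun_prop : Measurable fun r : (ℝ × ℝ) × (ℝ × ℝ) => (r.2.2, r.1.2 + r.2.1))
  have h2 : Measurable fun r : (ℝ × ℝ) × (ℝ × ℝ) =>
      B (r.1.1 - r.2.1 - r.2.2) (r.1.2 + r.2.1) :=
    hB.comp (by fun_prop : Measurable fun r : (ℝ × ℝ) × (ℝ × ℝ) =>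
      (r.1.1 - r.2.1 - r.2.2, r.1.2 + r.2.1))
  exact Measurable.ite (measurableSet_lt measurable_const (by fun_prop)) (h1.mul h2)
    measurable_const

lemma measurable_ampIter {q : ℝ → ℝ} (hq : Measurable q) (k : ℕ) :
    Measurable (Function.uncurry (ampIter q k)) := by
  induction k with
  | zero => exact measurable_const
  | succ k ih =>
    have h1 : Measurable fun r : ℝ × ℝ => if 0 < r.1 then q (r.2 + r.1) else 0 :=
      Measurable.ite (measurableSet_lt measurable_const (by fun_prop)) (by fun_prop)
        measurable_const
    have h2 := ((measurable_picardIntegrand ih).stronglyMeasurable.integral_prod_right'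
      (ν := (volume : Measure (ℝ × ℝ)))).measurable
    exact h1.sub h2

lemma measurable_majIntegrand {M : ℝ → ℝ≥0∞} (hM : Measurable M) :
    Measurable fun r : ℝ × (ℝ × ℝ) => if 0 < r.2.1 then M r.2.2 * M (r.1 - r.2.1 - r.2.2)
      else 0 :=
  Measurable.ite (measurableSet_lt measurable_const (by fun_prop))
    ((hM.comp (by fun_prop)).mul (hM.comp (by fun_prop))) measurable_const

lemma measurable_majIter (Q : ℝ≥0∞) (k : ℕ) : Measurable (majIter Q k) := by
  induction k with
  | zero => exact measurable_const
  | succ k ih =>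
    exact (Measurable.ite measurableSet_Ioi measurable_const measurable_const).add
      (measurable_majIntegrand ih).lintegral_prod_right'

lemma enorm_ampIter_le {q : ℝ → ℝ} {Q : ℝ≥0∞} (hQ : ∀ x, ‖q x‖ₑ ≤ Q) (k : ℕ) :
    ∀ α x, ‖ampIter q k α x‖ₑ ≤ majIter Q k α := by
  induction k with
  | zero => intro α x; simp [ampIter]
  | succ k ih =>
    intro α x
    refine (enorm_sub_le).trans (add_le_add ?_ ?_)
    · split_ifs <;> simp [hQ]
    · refine (enorm_integral_le_lintegral_enorm _).trans (lintegral_mono fun p => ?_)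
      dsimp only
      split_ifs
      · rw [enorm_mul]
        exact mul_le_mul' (ih _ _) (ih _ _)
      · simp

/-- Telescoping `aa' - bb' = (a - b)a' + b(a' - b')` transfers the domination of increments to
products. Adding the smaller majorant on the left replaces a subtraction in `ℝ≥0∞`. -/
lemma enorm_mul_sub_mul_add_le {a a' b b' : ℝ} {s s' m m' : ℝ≥0∞} (hb : ‖b‖ₑ ≤ s)
    (ha' : ‖a'‖ₑ ≤ m') (h : ‖a - b‖ₑ + s ≤ m) (h' : ‖a' - b'‖ₑ + s' ≤ m') :
    ‖a * a' - b * b'‖ₑ + s * s' ≤ m * m' := by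
  have e : a * a' - b * b' = (a - b) * a' + b * (a' - b') := by ring
  calc ‖a * a' - b * b'‖ₑ + s * s' ≤ (‖a - b‖ₑ * m' + s * ‖a' - b'‖ₑ) + s * s' := by
        rw [e]
        gcongr
        refine (enorm_add_le _ _).trans ?_
        rw [enorm_mul, enorm_mul]
        gcongr
    _ = ‖a - b‖ₑ * m' + s * (‖a' - b'‖ₑ + s') := by ring
    _ ≤ ‖a - b‖ₑ * m' + s * m' := by gcongr
    _ = (‖a - b‖ₑ + s) * m' := by ring
    _ ≤ m * m' := by gcongr

/-- The Picard step is affine plus quadratic, so by induction each increment of the iterates is at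
most the corresponding increment of the majorants. Summed over `k` the right side telescopes, which
gives absolute convergence wherever the majorants stay bounded. -/
lemma enorm_ampIter_sub_add_le {q : ℝ → ℝ} {Q : ℝ≥0∞} (hq : Measurable q)
    (hQ : ∀ x, ‖q x‖ₑ ≤ Q) (k : ℕ) :
    ∀ α x, ‖ampIter q (k + 1) α x - ampIter q k α x‖ₑ + majIter Q k α ≤ majIter Q (k + 1) α := by
  induction k with
  | zero =>
    intro α x
    simpa [majIter, ampIter] using enorm_ampIter_le hQ 1 α x
  | succ k ih =>
    intro α x
    -- A finite majorant is what makes the Bochner integrals below genuine; otherwise there is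
    -- nothing to prove.
    rcases eq_or_ne (majIter Q (k + 2) α) ⊤ with h | hfin
    · rw [h]; exact le_top
    set F : ℕ → ℝ × ℝ → ℝ := fun j p => if 0 < p.1 then
      ampIter q j p.2 (x + p.1) * ampIter q j (α - p.1 - p.2) (x + p.1) else 0 with hF
    set G : ℕ → ℝ × ℝ → ℝ≥0∞ := fun j p => if 0 < p.1 then
      majIter Q j p.2 * majIter Q j (α - p.1 - p.2) else 0 with hG
    have hFm : ∀ j, Measurable (F j) := fun j =>
      (measurable_picardIntegrand (measurable_ampIter hq j)).comp
        (measurable_prodMk_left (x := (α, x)))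
    have hGm : ∀ j, Measurable (G j) := fun j =>
      (measurable_majIntegrand (measurable_majIter Q j)).comp (measurable_prodMk_left (x := α))
    have hFG : ∀ j p, ‖F j p‖ₑ ≤ G j p := by
      intro j p
      simp only [hF, hG]
      split_ifs
      · rw [enorm_mul]
        exact mul_le_mul' (enorm_ampIter_le hQ _ _ _) (enorm_ampIter_le hQ _ _ _)
      · simp
    have hD : ∀ p, ‖F (k + 1) p - F k p‖ₑ + G k p ≤ G (k + 1) p := by
      intro p
      simp only [hF, hG]
      split_ifs
      · exact enorm_mul_sub_mul_add_le (enorm_ampIter_le hQ _ _ _) (enorm_ampIter_le hQ _ _ _)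
          (ih _ _) (ih _ _)
      · simp
    have hG1 : ∫⁻ p, G (k + 1) p ≠ ⊤ := by
      intro h
      exact hfin (by simp only [majIter]; simp only [hG] at h; simp only [majIter] at h; rw [h]; simp)
    have hG0 : ∫⁻ p, G k p ≠ ⊤ :=
      ne_top_of_le_ne_top hG1 (lintegral_mono fun p => le_add_self.trans (hD p))
    have hI : ∀ j, ∫⁻ p, G j p ≠ ⊤ → Integrable (F j) := fun j hj =>
      ⟨(hFm j).aestronglyMeasurable,
        (lintegral_mono (hFG j)).trans_lt (lt_top_iff_ne_top.2 hj)⟩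
    have e : ampIter q (k + 2) α x - ampIter q (k + 1) α x = -∫ p, (F (k + 1) p - F k p) := by
      rw [integral_sub (hI _ hG1) (hI _ hG0)]
      change ((if 0 < α then q (x + α) else 0) - ∫ p, F (k + 1) p) -
        ((if 0 < α then q (x + α) else 0) - ∫ p, F k p) = _
      ring
    calc _ ≤ (∫⁻ p, ‖F (k + 1) p - F k p‖ₑ) +
          ((if 0 < α then Q else 0) + ∫⁻ p, G k p) := by
          rw [e, enorm_neg]
          exact add_le_add (enorm_integral_le_lintegral_enorm _) le_rfl
      _ = (if 0 < α then Q else 0) + ∫⁻ p, (‖F (k + 1) p - F k p‖ₑ + G k p) := by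
          rw [lintegral_add_right _ (hGm k)]; ring
      _ ≤ (if 0 < α then Q else 0) + ∫⁻ p, G (k + 1) p := by
          gcongr with p; exact hD p

/-- If `α ≤ 0 < t`, then `β` and `α - t - β` cannot both be positive. This is why integrals over all
of `ℝ²` and two-sided Laplace transforms express the one-sided convolutions. -/
lemma ampIter_of_nonpos (q : ℝ → ℝ) (k : ℕ) : ∀ α x, α ≤ 0 → ampIter q k α x = 0 := by
  induction k with
  | zero => intro α x _; rfl
  | succ k ih =>
    intro α x hα
    have : (fun p : ℝ × ℝ => if 0 < p.1 then ampIter q k p.2 (x + p.1) *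
        ampIter q k (α - p.1 - p.2) (x + p.1) else 0) = fun _ => 0 := by
      funext p
      split_ifs with hp
      · rcases le_or_gt p.2 0 with h | h
        · rw [ih _ _ h, zero_mul]
        · rw [ih (α - p.1 - p.2) _ (by linarith), mul_zero]
      · rfl
    simp only [ampIter, picardStep]
    rw [this]
    simp [not_lt.2 hα]

/-! ### Weighted bounds for the majorants -/

/-- The exponential weight `e^{-2aα}` with values in `ℝ≥0∞`. -/
def expWeight (a α : ℝ) : ℝ≥0∞ := ENNReal.ofReal (Real.exp (-2 * α * a))

lemma measurable_expWeight (a : ℝ) : Measurable (expWeight a) := by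
  unfold expWeight; fun_prop

lemma expWeight_add (a s t : ℝ) : expWeight a (s + t) = expWeight a s * expWeight a t := by
  rw [expWeight, expWeight, expWeight, ← ENNReal.ofReal_mul (Real.exp_nonneg _), ← Real.exp_add]
  ring_nf

lemma lintegral_expWeight {a : ℝ} (ha : 0 < a) :
    ∫⁻ t, (if 0 < t then expWeight a t else 0) = ENNReal.ofReal (1 / (2 * a)) := by
  have h : (fun t => if 0 < t then expWeight a t else 0) = (Ioi 0).indicator (expWeight a) := by
    funext t; simp [indicator]
  rw [h, lintegral_indicator measurableSet_Ioi]
  unfold expWeight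
  have hint : IntegrableOn (fun t : ℝ => Real.exp ((-2 * a) * t)) (Ioi 0) := by
    have := exp_neg_integrableOn_Ioi 0 (b := 2 * a) (by positivity)
    simpa using this
  have e : ∀ t : ℝ, -2 * t * a = (-2 * a) * t := fun t => by ring
  simp_rw [e]
  rw [← ofReal_integral_eq_lintegral_ofReal hint (ae_of_all _ fun _ => Real.exp_nonneg _),
    integral_exp_mul_Ioi (by linarith)]
  congr 1
  simp

/-- The weight is multiplicative along `α = t + β + (α - t - β)`, so Tonelli and translation
invariance split the triple integral into a product. This is the term `n² / (2a)` of the scalar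
recursion. -/
lemma lintegral_expWeight_majStep {M : ℝ → ℝ≥0∞} (hM : Measurable M) (a : ℝ) :
    ∫⁻ α, ∫⁻ p : ℝ × ℝ, expWeight a α * (if 0 < p.1 then M p.2 * M (α - p.1 - p.2) else 0) =
      (∫⁻ t, (if 0 < t then expWeight a t else 0)) * (∫⁻ α, expWeight a α * M α) ^ 2 := by
  have hw := measurable_expWeight a
  have hwM : Measurable fun α => expWeight a α * M α := hw.mul hM
  rw [lintegral_lintegral_swap]
  swap
  · exact ((hw.comp measurable_fst).mul (measurable_majIntegrand hM)).aemeasurable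
  have h1 : ∀ p : ℝ × ℝ,
      ∫⁻ α, expWeight a α * (if 0 < p.1 then M p.2 * M (α - p.1 - p.2) else 0) =
      (if 0 < p.1 then expWeight a p.1 else 0) * (expWeight a p.2 * M p.2) *
        ∫⁻ α, expWeight a α * M α := by
    intro p
    split_ifs with hp
    · have e : ∀ α, expWeight a α * (M p.2 * M (α - p.1 - p.2)) =
          (expWeight a p.1 * (expWeight a p.2 * M p.2)) *
            (fun s => expWeight a s * M s) (α - (p.1 + p.2)) := by
        intro α
        have : α = p.1 + (p.2 + (α - (p.1 + p.2))) := by ring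
        conv_lhs => rw [this, expWeight_add, expWeight_add]
        rw [show p.1 + (p.2 + (α - (p.1 + p.2))) - p.1 - p.2 = α - (p.1 + p.2) by ring]
        ring
      have hs : Measurable fun α => (fun s => expWeight a s * M s) (α - (p.1 + p.2)) :=
        hwM.comp (by fun_prop)
      rw [lintegral_congr e, lintegral_const_mul _ hs,
        lintegral_sub_right_eq_self (fun s => expWeight a s * M s)]
    · simp
  simp_rw [h1]
  have hm : Measurable fun t : ℝ => if 0 < t then expWeight a t else 0 :=
    Measurable.ite measurableSet_Ioi hw measurable_const
  have hmM : Measurable fun p : ℝ × ℝ =>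
      (if 0 < p.1 then expWeight a p.1 else 0) * (expWeight a p.2 * M p.2) :=
    (hm.comp measurable_fst).mul (hwM.comp measurable_snd)
  rw [lintegral_mul_const _ hmM, Measure.volume_eq_prod,
    lintegral_prod_mul hm.aemeasurable hwM.aemeasurable]
  ring

/-- The Laplace transform of the limit of the majorants: the small root of
`2 a n = Q + n²`. -/
def majBound (Q a : ℝ) : ℝ := a - Real.sqrt (a ^ 2 - Q)

lemma majBound_eq {Q a : ℝ} (ha : 0 < a) (h : Q < a ^ 2) :
    Q * (1 / (2 * a)) + 1 / (2 * a) * majBound Q a ^ 2 = majBound Q a := by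
  have : Real.sqrt (a ^ 2 - Q) ^ 2 = a ^ 2 - Q := Real.sq_sqrt (by linarith)
  unfold majBound
  field_simp
  linear_combination this

lemma majBound_nonneg {Q a : ℝ} (hQ : 0 ≤ Q) (ha : 0 < a) : 0 ≤ majBound Q a := by
  unfold majBound
  rw [sub_nonneg, Real.sqrt_le_left ha.le]
  linarith

lemma majBound_lt {Q a : ℝ} (h : Q < a ^ 2) : majBound Q a < a := by
  unfold majBound
  have := Real.sqrt_pos.2 (sub_pos.2 h)
  linarith

/-- The weighted integrals start at `0` and evolve under `n ↦ (Q + n²)/(2a)`, which is increasing on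
`n ≥ 0` and fixes `majBound`; they can never pass the fixed point. -/
lemma lintegral_expWeight_majIter_le {Q a : ℝ} (hQ : 0 ≤ Q) (ha : 0 < a) (h : Q < a ^ 2) (k : ℕ) :
    ∫⁻ α, expWeight a α * majIter (ENNReal.ofReal Q) k α ≤ ENNReal.ofReal (majBound Q a) := by
  induction k with
  | zero => simp [majIter]
  | succ k ih =>
    have hM := measurable_majIter (ENNReal.ofReal Q) k
    have hw := measurable_expWeight a
    have hi : Measurable fun α : ℝ => if 0 < α then ENNReal.ofReal Q else 0 :=
      Measurable.ite measurableSet_Ioi measurable_const measurable_const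
    simp only [majIter, mul_add]
    have hwi : Measurable fun α => expWeight a α * (if 0 < α then ENNReal.ofReal Q else 0) :=
      hw.mul hi
    rw [lintegral_add_left hwi]
    have e1 : ∀ α, expWeight a α * (if 0 < α then ENNReal.ofReal Q else 0) =
        ENNReal.ofReal Q * (if 0 < α then expWeight a α else 0) := by
      intro α; split_ifs <;> simp [mul_comm]
    have e2 : ∀ α, expWeight a α * ∫⁻ p : ℝ × ℝ, (if 0 < p.1 then
        majIter (ENNReal.ofReal Q) k p.2 * majIter (ENNReal.ofReal Q) k (α - p.1 - p.2) else 0) =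
        ∫⁻ p : ℝ × ℝ, expWeight a α * (if 0 < p.1 then
        majIter (ENNReal.ofReal Q) k p.2 * majIter (ENNReal.ofReal Q) k (α - p.1 - p.2) else 0) :=
      fun α => (lintegral_const_mul _ ((measurable_majIntegrand hM).comp
        (measurable_prodMk_left (x := α)))).symm
    simp_rw [e1, e2]
    rw [lintegral_const_mul' _ _ ENNReal.ofReal_ne_top, lintegral_expWeight_majStep hM,
      lintegral_expWeight ha]
    calc _ ≤ ENNReal.ofReal Q * ENNReal.ofReal (1 / (2 * a)) +
          ENNReal.ofReal (1 / (2 * a)) * ENNReal.ofReal (majBound Q a) ^ 2 := by gcongr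
      _ = ENNReal.ofReal (Q * (1 / (2 * a)) + 1 / (2 * a) * majBound Q a ^ 2) := by
          rw [ENNReal.ofReal_add (by positivity) (by positivity), ENNReal.ofReal_mul hQ,
            ENNReal.ofReal_mul (by positivity), ENNReal.ofReal_pow (majBound_nonneg hQ ha)]
      _ = _ := by rw [majBound_eq ha h]

/-! ### The Laplace transform and the Picard step -/

lemma enorm_cexp_neg_two (κ : ℂ) (α : ℝ) :
    ‖Complex.exp (-2 * (α : ℂ) * κ)‖ₑ = expWeight κ.re α := by
  rw [expWeight, ← ofReal_norm, Complex.norm_exp]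
  simp

lemma norm_cexp_neg_two (κ : ℂ) (α : ℝ) :
    ‖Complex.exp (-2 * (α : ℂ) * κ)‖ = Real.exp (-2 * α * κ.re) := by
  rw [Complex.norm_exp]
  simp

lemma measurable_cexp_neg_two (κ : ℂ) : Measurable fun α : ℝ => Complex.exp (-2 * (α : ℂ) * κ) := by
  fun_prop

lemma cexp_neg_two_add (κ : ℂ) (s t : ℝ) : Complex.exp (-2 * ((s + t : ℝ) : ℂ) * κ) =
    Complex.exp (-2 * (s : ℂ) * κ) * Complex.exp (-2 * (t : ℂ) * κ) := by
  rw [← Complex.exp_add]; push_cast; ring_nf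

/-- The Laplace transform `∫ f(α) e^{-2ακ} dα`. -/
def laplace (f : ℝ → ℝ) (κ : ℂ) : ℂ := ∫ α : ℝ, (f α : ℂ) * Complex.exp (-2 * (α : ℂ) * κ)

lemma integrable_mul_cexp {f : ℝ → ℝ} {M : ℝ → ℝ≥0∞} {κ : ℂ}
    (hf : AEStronglyMeasurable f) (hfM : ∀ᵐ α, ‖f α‖ₑ ≤ M α)
    (hM : ∫⁻ α, expWeight κ.re α * M α ≠ ⊤) :
    Integrable fun α : ℝ => (f α : ℂ) * Complex.exp (-2 * (α : ℂ) * κ) := by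
  refine ⟨(Complex.continuous_ofReal.comp_aestronglyMeasurable hf).mul
    (measurable_cexp_neg_two κ).aestronglyMeasurable, ?_⟩
  refine (lintegral_mono_ae (hfM.mono fun α h => ?_)).trans_lt (lt_top_iff_ne_top.2 hM)
  rw [enorm_mul, enorm_cexp_neg_two, mul_comm]
  gcongr
  simpa [← ofReal_norm] using h

lemma enorm_laplace_le {f : ℝ → ℝ} {M : ℝ → ℝ≥0∞} {κ : ℂ} (hfM : ∀ᵐ α, ‖f α‖ₑ ≤ M α) :
    ‖laplace f κ‖ₑ ≤ ∫⁻ α, expWeight κ.re α * M α := by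
  refine (enorm_integral_le_lintegral_enorm _).trans (lintegral_mono_ae (hfM.mono fun α h => ?_))
  rw [enorm_mul, enorm_cexp_neg_two, mul_comm]
  gcongr
  simpa [← ofReal_norm] using h

lemma integrableOn_cexp_neg_two {κ : ℂ} (hκ : 0 < κ.re) :
    IntegrableOn (fun t : ℝ => Complex.exp (-2 * (t : ℂ) * κ)) (Ioi 0) := by
  refine ⟨(measurable_cexp_neg_two κ).aestronglyMeasurable, ?_⟩
  have h := lintegral_expWeight hκ
  have e : (fun t => if 0 < t then expWeight κ.re t else 0) =
    (Ioi 0).indicator (expWeight κ.re) := by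
    funext t; simp [indicator]
  rw [e, lintegral_indicator measurableSet_Ioi] at h
  simp only [HasFiniteIntegral, enorm_cexp_neg_two, h, ENNReal.ofReal_lt_top]

lemma integrableOn_cexp_mul {κ : ℂ} (hκ : 0 < κ.re) {g : ℝ → ℂ} (hg : Measurable g) {C : ℝ}
    (hC : ∀ t, ‖g t‖ ≤ C) :
    IntegrableOn (fun t : ℝ => Complex.exp (-2 * (t : ℂ) * κ) * g t) (Ioi 0) :=
  (integrableOn_cexp_neg_two hκ).mul_bdd (c := C) hg.aestronglyMeasurable (ae_of_all _ hC)

lemma measurable_laplace {B : ℝ → ℝ → ℝ} (hB : Measurable (Function.uncurry B)) (κ : ℂ) :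
    Measurable fun x => laplace (fun α => B α x) κ := by
  have : Measurable fun r : ℝ × ℝ => (B r.2 r.1 : ℂ) * Complex.exp (-2 * (r.2 : ℂ) * κ) := by
    have h := hB.comp measurable_swap
    exact (Complex.measurable_ofReal.comp h).mul (by fun_prop)
  exact (this.stronglyMeasurable.integral_prod_right' (ν := (volume : Measure ℝ))).measurable

/-- Convolution in `α` becomes a square, and integration over `t` along the characteristic `x + t`
survives. The finite weighted majorant justifies Fubini. -/
lemma laplace_picardStep {q : ℝ → ℝ} (hq : Measurable q) {Q : ℝ} (hQ : ∀ x, |q x| ≤ Q)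
    {B : ℝ → ℝ → ℝ} (hB : Measurable (Function.uncurry B)) {M : ℝ → ℝ≥0∞} (hM : Measurable M)
    (hBM : ∀ α x, ‖B α x‖ₑ ≤ M α) {κ : ℂ} (hκ : 0 < κ.re)
    (hfin : ∫⁻ α, expWeight κ.re α * M α ≠ ⊤) (x : ℝ) :
    laplace (fun α => picardStep q B α x) κ =
      ∫ t in Ioi (0 : ℝ), Complex.exp (-2 * (t : ℂ) * κ) *
        ((q (x + t) : ℂ) - laplace (fun α => B α (x + t)) κ ^ 2) := by
  set E : ℝ → ℂ := fun α => Complex.exp (-2 * (α : ℂ) * κ) with hE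
  have hEm : Measurable E := measurable_cexp_neg_two κ
  set n : ℝ → ℂ := fun y => laplace (fun α => B α y) κ with hn
  have hnm : Measurable n := measurable_laplace hB κ
  have hnb : ∀ y, ‖n y‖ ≤ (∫⁻ α, expWeight κ.re α * M α).toReal := fun y => by
    rw [← toReal_enorm]
    exact ENNReal.toReal_mono hfin (enorm_laplace_le (ae_of_all _ fun α => hBM α y))
  -- the linear term
  have hi1 : IntegrableOn (fun t => E t * (q (x + t) : ℂ)) (Ioi 0) :=
    integrableOn_cexp_mul hκ (by fun_prop) (C := Q) fun t => by simpa using hQ (x + t)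
  have hi2 : IntegrableOn (fun t => E t * n (x + t) ^ 2) (Ioi 0) :=
    integrableOn_cexp_mul hκ (by fun_prop)
      (C := (∫⁻ α, expWeight κ.re α * M α).toReal ^ 2) fun t => by
        rw [norm_pow]; gcongr; exact hnb _
  have el : (fun α => ((if 0 < α then q (x + α) else 0 : ℝ) : ℂ) * E α) =
      (Ioi 0).indicator fun t => E t * (q (x + t) : ℂ) := by
    funext α
    by_cases h : 0 < α <;> simp [h, mul_comm]
  -- the quadratic term
  set F : ℝ → ℝ × ℝ → ℂ := fun α p =>
    ((if 0 < p.1 then B p.2 (x + p.1) * B (α - p.1 - p.2) (x + p.1) else 0 : ℝ) : ℂ) * E α with hF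
  have hFm : Measurable (Function.uncurry F) := by
    have h := (measurable_picardIntegrand hB).comp
      (by fun_prop : Measurable fun r : ℝ × (ℝ × ℝ) => ((r.1, x), r.2))
    exact (Complex.measurable_ofReal.comp h).mul (hEm.comp measurable_fst)
  have hFi : Integrable (Function.uncurry F) ((volume : Measure ℝ).prod volume) := by
    refine ⟨hFm.aestronglyMeasurable, ?_⟩
    have hle : ∀ r : ℝ × (ℝ × ℝ), ‖Function.uncurry F r‖ₑ ≤ expWeight κ.re r.1 *
        (if 0 < r.2.1 then M r.2.2 * M (r.1 - r.2.1 - r.2.2) else 0) := by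
      rintro ⟨α, p⟩
      simp only [Function.uncurry, hF, hE]
      rw [enorm_mul, enorm_cexp_neg_two, mul_comm]
      gcongr
      split_ifs
      · rw [← ofReal_norm, Complex.norm_real, ofReal_norm, enorm_mul]
        exact mul_le_mul' (hBM _ _) (hBM _ _)
      · simp
    refine (lintegral_mono hle).trans_lt ?_
    have hm : Measurable fun r : ℝ × (ℝ × ℝ) => expWeight κ.re r.1 *
        (if 0 < r.2.1 then M r.2.2 * M (r.1 - r.2.1 - r.2.2) else 0) :=
      ((measurable_expWeight _).comp measurable_fst).mul (measurable_majIntegrand hM)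
    rw [lintegral_prod _ hm.aemeasurable, lintegral_expWeight_majStep hM,
      lintegral_expWeight hκ]
    exact ENNReal.mul_lt_top ENNReal.ofReal_lt_top (ENNReal.pow_lt_top (lt_top_iff_ne_top.2 hfin))
  have hinner : ∀ p : ℝ × ℝ, ∫ α, F α p =
      if 0 < p.1 then E p.1 * n (x + p.1) * ((B p.2 (x + p.1) : ℂ) * E p.2) else 0 := by
    intro p
    by_cases hp : 0 < p.1
    · have e : ∀ α, F α p = (E p.1 * ((B p.2 (x + p.1) : ℂ) * E p.2)) *
          (fun s => (B s (x + p.1) : ℂ) * E s) (α - (p.1 + p.2)) := by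
        intro α
        simp only [hF, hp, if_true]
        have : α = p.1 + (p.2 + (α - (p.1 + p.2))) := by ring
        have h3 : E α = E p.1 * (E p.2 * E (α - (p.1 + p.2))) := by
          conv_lhs => rw [this]
          simp only [hE]
          rw [cexp_neg_two_add, cexp_neg_two_add]
        rw [h3, sub_sub]
        push_cast
        ring
      simp_rw [e]
      rw [integral_const_mul, integral_sub_right_eq_self (fun s => (B s (x + p.1) : ℂ) * E s)]
      simp only [hp, if_true, hn, laplace, hE]
      ring
    · simp [hF, hp]
  have hquad : ∫ α, ∫ p, F α p = ∫ t in Ioi (0 : ℝ), E t * n (x + t) ^ 2 := by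
    rw [integral_integral_swap hFi]
    have hi3 : Integrable (fun p : ℝ × ℝ => ∫ α, F α p) := hFi.integral_prod_right
    simp_rw [hinner] at hi3 ⊢
    rw [Measure.volume_eq_prod] at hi3 ⊢
    rw [integral_prod _ hi3, ← integral_indicator measurableSet_Ioi]
    congr 1
    funext t
    by_cases ht : 0 < t
    · simp only [ht, if_true]
      rw [integral_const_mul, indicator_of_mem (mem_Ioi.2 ht)]
      simp only [hn, laplace, hE]
      ring
    · simp [ht]
  have hsub : ∀ α, ((picardStep q B α x : ℝ) : ℂ) * E α =
      ((if 0 < α then q (x + α) else 0 : ℝ) : ℂ) * E α - ∫ p, F α p := by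
    intro α
    simp only [picardStep, hF]
    rw [integral_mul_const, integral_complex_ofReal]
    push_cast
    ring
  have : laplace (fun α => picardStep q B α x) κ = ∫ α, (((picardStep q B α x : ℝ) : ℂ) * E α) :=
    rfl
  rw [this]
  simp_rw [hsub]
  have hi4 : Integrable fun α => ∫ p, F α p := hFi.integral_prod_left
  rw [integral_sub _ hi4, hquad, el, integral_indicator measurableSet_Ioi,
    ← integral_sub hi1 hi2]
  · simp_rw [mul_sub, hE, hn]
  · rw [el]; exact hi1.integrable_indicator measurableSet_Ioi

/-! ### The limit amplitude and the Riccati equation -/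

/-- The pointwise supremum of the majorants. -/
def majSup (Q : ℝ≥0∞) (α : ℝ) : ℝ≥0∞ := ⨆ k, majIter Q k α

lemma majIter_mono (Q : ℝ≥0∞) : Monotone (majIter Q) :=
  monotone_nat_of_le_succ fun k α => le_add_self.trans
    -- The majorants do not depend on the potential, so the increment estimate for potential `0`
    -- already contains their monotonicity.
    (enorm_ampIter_sub_add_le (q := fun _ => 0) measurable_const (by simp) k α 0)

lemma lintegral_expWeight_majSup_le {Q a : ℝ} (hQ : 0 ≤ Q) (ha : 0 < a) (h : Q < a ^ 2) :
    ∫⁻ α, expWeight a α * majSup (ENNReal.ofReal Q) α ≤ ENNReal.ofReal (majBound Q a) := by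
  simp_rw [majSup, ENNReal.mul_iSup]
  have hm : ∀ k, Measurable fun α => expWeight a α * majIter (ENNReal.ofReal Q) k α :=
    fun k => (measurable_expWeight a).mul (measurable_majIter _ k)
  rw [lintegral_iSup hm
    (fun i j hij α => by dsimp only; gcongr; exact majIter_mono _ hij α)]
  exact iSup_le fun k => lintegral_expWeight_majIter_le hQ ha h k

lemma lintegral_expWeight_majSup_ne_top {Q a : ℝ} (hQ : 0 ≤ Q) (ha : 0 < a) (h : Q < a ^ 2) :
    ∫⁻ α, expWeight a α * majSup (ENNReal.ofReal Q) α ≠ ⊤ :=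
  ne_top_of_le_ne_top ENNReal.ofReal_ne_top (lintegral_expWeight_majSup_le hQ ha h)

lemma measurable_majSup (Q : ℝ≥0∞) : Measurable (majSup Q) :=
  Measurable.iSup fun k => measurable_majIter Q k

lemma ae_majSup_lt_top {Q : ℝ} (hQ : 0 ≤ Q) : ∀ᵐ α, majSup (ENNReal.ofReal Q) α < ⊤ := by
  have h := ae_lt_top ((measurable_expWeight (Q + 1)).mul (measurable_majSup _))
    -- Any `a` with `a² > Q` serves; `a = Q + 1` needs no case distinction.
    (lintegral_expWeight_majSup_ne_top hQ (by positivity) (by nlinarith : Q < (Q + 1) ^ 2))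
  refine h.mono fun α hα => ?_
  rw [lt_top_iff_ne_top]
  intro htop
  simp only [Pi.mul_apply, htop] at hα
  rw [ENNReal.mul_top (by simp [expWeight, Real.exp_pos])] at hα
  exact lt_irrefl _ hα

/-- The `x`-dependent `A`-amplitude. -/
def amp (q : ℝ → ℝ) (α x : ℝ) : ℝ := limUnder atTop fun k => ampIter q k α x

section

variable {q : ℝ → ℝ} {Q : ℝ}

lemma enorm_le_of_abs_le (hQ : ∀ x, |q x| ≤ Q) (x : ℝ) : ‖q x‖ₑ ≤ ENNReal.ofReal Q := by
  rw [← ofReal_norm]; exact ENNReal.ofReal_le_ofReal (hQ x)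

lemma enorm_ampIter_le_majSup (hQ : ∀ x, |q x| ≤ Q) (k : ℕ) (α x : ℝ) :
    ‖ampIter q k α x‖ₑ ≤ majSup (ENNReal.ofReal Q) α :=
  (enorm_ampIter_le (enorm_le_of_abs_le hQ) k α x).trans
    (le_iSup (fun k => majIter (ENNReal.ofReal Q) k α) k)

lemma tendsto_ampIter (hq : Measurable q) (hQ : ∀ x, |q x| ≤ Q) {α : ℝ}
    (hα : majSup (ENNReal.ofReal Q) α < ⊤) (x : ℝ) :
    Tendsto (fun k => ampIter q k α x) atTop (𝓝 (amp q α x)) := by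
  set D : ℕ → ℝ≥0∞ := fun k => ‖ampIter q (k + 1) α x - ampIter q k α x‖ₑ
  have hsum : ∀ k, ∑ j ∈ Finset.range k, D j ≤ majIter (ENNReal.ofReal Q) k α := by
    intro k
    induction k with
    | zero => simp
    | succ k ih =>
      rw [Finset.sum_range_succ, add_comm]
      exact (add_le_add le_rfl ih).trans
        (enorm_ampIter_sub_add_le hq (enorm_le_of_abs_le hQ) k α x)
  have hD : ∑' k, D k ≠ ⊤ := by
    refine ne_top_of_le_ne_top hα.ne ?_
    rw [ENNReal.tsum_eq_iSup_nat]
    exact iSup_mono hsum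
  refine (cauchySeq_of_edist_le_of_tsum_ne_top D (fun k => ?_) hD).tendsto_limUnder
  rw [edist_comm, edist_eq_enorm_sub]

lemma measurable_amp (hq : Measurable q) (x : ℝ) : Measurable fun α => amp q α x :=
  (StronglyMeasurable.limUnder fun k => ((measurable_ampIter hq k).comp
    (measurable_prodMk_right (y := x))).stronglyMeasurable).measurable

lemma amp_of_nonpos (q : ℝ → ℝ) {α : ℝ} (hα : α ≤ 0) (x : ℝ) : amp q α x = 0 := by
  have : (fun k => ampIter q k α x) = fun _ => 0 := by
    funext k; exact ampIter_of_nonpos q k α x hα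
  rw [amp, this]
  exact tendsto_const_nhds.limUnder_eq

lemma enorm_amp_le (hq : Measurable q) (hQ : ∀ x, |q x| ≤ Q) (x : ℝ) :
    ∀ᵐ α, ‖amp q α x‖ₑ ≤ majSup (ENNReal.ofReal Q) α := by
  have hQ0 : 0 ≤ Q := (abs_nonneg _).trans (hQ 0)
  filter_upwards [ae_majSup_lt_top hQ0] with α hα
  exact le_of_tendsto (tendsto_ampIter hq hQ hα x).enorm
    (Eventually.of_forall fun k => enorm_ampIter_le_majSup hQ k α x)

variable {κ : ℂ}

lemma integrable_amp_mul_cexp (hq : Measurable q) (hQ : ∀ x, |q x| ≤ Q) (hκ : 0 < κ.re)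
    (h : Q < κ.re ^ 2) (x : ℝ) :
    Integrable fun α : ℝ => (amp q α x : ℂ) * Complex.exp (-2 * (α : ℂ) * κ) :=
  integrable_mul_cexp (measurable_amp hq x).aestronglyMeasurable (enorm_amp_le hq hQ x)
    (lintegral_expWeight_majSup_ne_top ((abs_nonneg _).trans (hQ 0)) hκ h)

lemma norm_laplace_le_majBound (hQ : 0 ≤ Q) (hκ : 0 < κ.re) (h : Q < κ.re ^ 2) {f : ℝ → ℝ}
    (hf : ∀ᵐ α, ‖f α‖ₑ ≤ majSup (ENNReal.ofReal Q) α) : ‖laplace f κ‖ ≤ majBound Q κ.re := by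
  rw [← toReal_enorm]
  exact ENNReal.toReal_le_of_le_ofReal (majBound_nonneg hQ hκ)
    ((enorm_laplace_le hf).trans (lintegral_expWeight_majSup_le hQ hκ h))

lemma tendsto_laplace_ampIter (hq : Measurable q) (hQ : ∀ x, |q x| ≤ Q) (hκ : 0 < κ.re)
    (h : Q < κ.re ^ 2) (x : ℝ) :
    Tendsto (fun k => laplace (fun α => ampIter q k α x) κ) atTop
      (𝓝 (laplace (fun α => amp q α x) κ)) := by
  have hQ0 : 0 ≤ Q := (abs_nonneg _).trans (hQ 0)
  have hfin := lintegral_expWeight_majSup_ne_top hQ0 hκ h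
  refine tendsto_integral_of_dominated_convergence
    (fun α => (expWeight κ.re α * majSup (ENNReal.ofReal Q) α).toReal) (fun k => ?_) ?_ ?_ ?_
  · exact (((Complex.measurable_ofReal.comp ((measurable_ampIter hq k).comp
      (measurable_prodMk_right (y := x))))).mul (measurable_cexp_neg_two κ)).aestronglyMeasurable
  · exact integrable_toReal_of_lintegral_ne_top
      ((measurable_expWeight _).mul (measurable_majSup _)).aemeasurable hfin
  · intro k
    filter_upwards [ae_majSup_lt_top hQ0] with α hα
    rw [← toReal_enorm]
    refine ENNReal.toReal_mono (ENNReal.mul_ne_top ENNReal.ofReal_ne_top hα.ne) ?_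
    rw [enorm_mul, enorm_cexp_neg_two, mul_comm]
    gcongr
    simpa [← ofReal_norm] using enorm_ampIter_le_majSup hQ k α x
  · filter_upwards [ae_majSup_lt_top hQ0] with α hα
    exact ((Complex.continuous_ofReal.tendsto _).comp (tendsto_ampIter hq hQ hα x)).mul_const _

/-- The Laplace transform in `α` of the `x`-dependent `A`-amplitude. -/
def riccati (q : ℝ → ℝ) (κ : ℂ) (x : ℝ) : ℂ := laplace (fun α => amp q α x) κ

lemma norm_riccati_le (hq : Measurable q) (hQ : ∀ x, |q x| ≤ Q) (hκ : 0 < κ.re)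
    (h : Q < κ.re ^ 2) (x : ℝ) : ‖riccati q κ x‖ ≤ majBound Q κ.re :=
  norm_laplace_le_majBound ((abs_nonneg _).trans (hQ 0)) hκ h (enorm_amp_le hq hQ x)

lemma measurable_riccati (hq : Measurable q) (hQ : ∀ x, |q x| ≤ Q) (hκ : 0 < κ.re)
    (h : Q < κ.re ^ 2) : Measurable (riccati q κ) :=
  measurable_of_tendsto_metrizable (fun k => measurable_laplace (measurable_ampIter hq k) κ)
    (tendsto_pi_nhds.2 fun x => tendsto_laplace_ampIter hq hQ hκ h x)

/-- The integrated form of the Riccati equation `n' = 2κn + n² - q`. -/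
lemma riccati_eq (hq : Measurable q) (hQ : ∀ x, |q x| ≤ Q) (hκ : 0 < κ.re)
    (h : Q < κ.re ^ 2) (x : ℝ) :
    riccati q κ x = ∫ t in Ioi (0 : ℝ), Complex.exp (-2 * (t : ℂ) * κ) *
        ((q (x + t) : ℂ) - riccati q κ (x + t) ^ 2) := by
  have hQ0 : 0 ≤ Q := (abs_nonneg _).trans (hQ 0)
  have hfin := lintegral_expWeight_majSup_ne_top hQ0 hκ h
  have h1 := (tendsto_laplace_ampIter hq hQ hκ h x).comp (tendsto_add_atTop_nat 1)
  refine tendsto_nhds_unique h1 ?_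
  have e : ∀ k, laplace (fun α => ampIter q (k + 1) α x) κ = ∫ t in Ioi (0 : ℝ),
      Complex.exp (-2 * (t : ℂ) * κ) *
        ((q (x + t) : ℂ) - laplace (fun α => ampIter q k α (x + t)) κ ^ 2) := fun k =>
    laplace_picardStep hq hQ (measurable_ampIter hq k) (measurable_majSup _)
      (enorm_ampIter_le_majSup hQ k) hκ hfin x
  simp only [Function.comp_def, e]
  refine tendsto_integral_of_dominated_convergence
    (fun t => ‖Complex.exp (-2 * (t : ℂ) * κ)‖ * (Q + majBound Q κ.re ^ 2)) (fun k => ?_) ?_ ?_ ?_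
  · have hm : Measurable fun t => laplace (fun α => ampIter q k α (x + t)) κ :=
      (measurable_laplace (measurable_ampIter hq k) κ).comp (measurable_const_add x)
    exact Measurable.aestronglyMeasurable (by fun_prop)
  · exact (integrableOn_cexp_neg_two hκ).norm.mul_const _
  · refine fun k => ae_of_all _ fun t => ?_
    rw [norm_mul]
    gcongr
    refine (norm_sub_le _ _).trans (add_le_add (by simpa using hQ (x + t)) ?_)
    rw [norm_pow]
    gcongr
    exact norm_laplace_le_majBound hQ0 hκ h (ae_of_all _ fun α => enorm_ampIter_le_majSup hQ k α _)
  · refine ae_of_all _ fun t => ?_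
    exact ((tendsto_laplace_ampIter hq hQ hκ h (x + t)).pow 2).const_sub _ |>.const_mul _

end

/-! ### Integration by parts for primitives of integrable functions -/

lemma intervalIntegral_swap_triangle {f g : ℝ → ℂ} {x : ℝ} (hx : 0 ≤ x)
    (hf : IntervalIntegrable f volume 0 x) (hg : IntervalIntegrable g volume 0 x) :
    ∫ s in (0 : ℝ)..x, (∫ t in (0 : ℝ)..s, f t) * g s =
      ∫ t in (0 : ℝ)..x, f t * ∫ s in t..x, g s := by
  have hf' : IntegrableOn f (Ioc 0 x) := (intervalIntegrable_iff_integrableOn_Ioc_of_le hx).1 hf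
  have hg' : IntegrableOn g (Ioc 0 x) := (intervalIntegrable_iff_integrableOn_Ioc_of_le hx).1 hg
  set F : ℝ → ℝ → ℂ := fun s t => {r : ℝ × ℝ | r.2 ≤ r.1}.indicator (fun r => g r.1 * f r.2) (s, t)
    with hF
  have hFi : Integrable (Function.uncurry F)
      ((volume.restrict (Ioc 0 x)).prod (volume.restrict (Ioc 0 x))) :=
    (hg'.mul_prod hf').indicator (measurableSet_le measurable_snd measurable_fst)
  have key := integral_integral_swap hFi
  rw [intervalIntegral.integral_of_le hx, intervalIntegral.integral_of_le hx]
  calc _ = ∫ s in Ioc 0 x, ∫ t in Ioc 0 x, F s t := by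
        refine setIntegral_congr_fun measurableSet_Ioc fun s hs => ?_
        have e : F s = (Iic s).indicator fun t => g s * f t := by
          funext t
          simp only [hF, indicator_apply, mem_ofPred_eq, mem_Iic]
        rw [e, setIntegral_indicator measurableSet_Iic, intervalIntegral.integral_of_le hs.1.le,
          integral_const_mul, mul_comm, Ioc_inter_Iic, min_eq_right hs.2]
    _ = ∫ t in Ioc 0 x, ∫ s in Ioc 0 x, F s t := key
    _ = _ := by
        refine setIntegral_congr_fun measurableSet_Ioc fun t ht => ?_
        have e : (fun s => F s t) = (Ici t).indicator fun s => g s * f t := by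
          funext s
          simp only [hF, indicator_apply, mem_ofPred_eq, mem_Ici]
        rw [e, setIntegral_indicator measurableSet_Ici, intervalIntegral.integral_of_le ht.2,
          integral_mul_const, mul_comm, ← integral_Icc_eq_integral_Ioc]
        congr 2
        congr 1
        ext s
        simp only [mem_inter_iff, mem_Ioc, mem_Ici, mem_Icc]
        constructor
        · rintro ⟨⟨_, h2⟩, h3⟩; exact ⟨h3, h2⟩
        · rintro ⟨h1, h2⟩; exact ⟨⟨ht.1.trans_le h1, h2⟩, h1⟩

/-- The product rule, in integrated form, for a primitive `P` of an integrable function and a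
`C¹` function `w`. -/
lemma primitive_mul_eq {P p w w' : ℝ → ℂ} {x : ℝ} (hx : 0 ≤ x)
    (hP : ∀ s ∈ Icc 0 x, P s = P 0 + ∫ t in (0 : ℝ)..s, p t) (hp : IntervalIntegrable p volume 0 x)
    (hw : ∀ s ∈ Icc 0 x, HasDerivWithinAt w (w' s) (Ici 0) s) (hw' : ContinuousOn w' (Icc 0 x)) :
    P x * w x = P 0 * w 0 + ∫ s in (0 : ℝ)..x, (p s * w s + P s * w' s) := by
  have hwc : ContinuousOn w (Icc 0 x) := fun s hs =>
    (hw s hs).continuousWithinAt.mono fun y hy => hy.1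
  have hPc : ContinuousOn P (Icc 0 x) := by
    have h : ContinuousOn (fun s => P 0 + ∫ t in (0 : ℝ)..s, p t) (Icc 0 x) := by
      have := intervalIntegral.continuousOn_primitive_interval'
        (μ := volume) (a := 0) hp left_mem_uIcc
      rw [uIcc_of_le hx] at this
      exact continuousOn_const.add this
    exact h.congr hP
  have hw'i : IntervalIntegrable w' volume 0 x := by
    refine ContinuousOn.intervalIntegrable ?_
    rwa [uIcc_of_le hx]
  have hFTC : ∀ t ∈ Icc 0 x, ∫ s in t..x, w' s = w x - w t := by
    intro t ht
    refine intervalIntegral.integral_eq_sub_of_hasDeriv_right_of_le ht.2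
      (hwc.mono (Icc_subset_Icc_left ht.1)) (fun s hs => ?_) (hw'i.mono_set ?_)
    · exact (hw s ⟨ht.1.trans hs.1.le, hs.2.le⟩).mono fun y hy =>
        (ht.1.trans hs.1.le).trans (le_of_lt hy)
    · rw [uIcc_of_le hx, uIcc_of_le ht.2]; exact Icc_subset_Icc_left ht.1
  have hpw : IntervalIntegrable (fun s => p s * w s) volume 0 x :=
    hp.mul_continuousOn (by rwa [uIcc_of_le hx])
  have hPw : IntervalIntegrable (fun s => P s * w' s) volume 0 x :=
    ContinuousOn.intervalIntegrable (by rw [uIcc_of_le hx]; exact hPc.mul hw')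
  have hprim : IntervalIntegrable (fun s => (∫ t in (0 : ℝ)..s, p t) * w' s) volume 0 x := by
    refine ContinuousOn.intervalIntegrable ?_
    have := intervalIntegral.continuousOn_primitive_interval'
      (μ := volume) (a := 0) hp left_mem_uIcc
    refine this.mul ?_
    rwa [uIcc_of_le hx]
  rw [intervalIntegral.integral_add hpw hPw]
  have e1 : ∫ s in (0 : ℝ)..x, P s * w' s = P 0 * (w x - w 0) +
      ∫ t in (0 : ℝ)..x, p t * (w x - w t) := by
    have h1 : ∫ s in (0 : ℝ)..x, P s * w' s =
        ∫ s in (0 : ℝ)..x, (P 0 * w' s + (∫ t in (0 : ℝ)..s, p t) * w' s) := by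
      refine intervalIntegral.integral_congr fun s hs => ?_
      rw [uIcc_of_le hx] at hs
      rw [hP s hs]; ring
    rw [h1, intervalIntegral.integral_add (hw'i.const_mul _) hprim,
      intervalIntegral.integral_const_mul, hFTC 0 ⟨le_rfl, hx⟩,
      intervalIntegral_swap_triangle hx hp hw'i]
    congr 1
    refine intervalIntegral.integral_congr fun t ht => ?_
    rw [uIcc_of_le hx] at ht
    rw [hFTC t ht]
  rw [e1, hP x ⟨hx, le_rfl⟩]
  have e2 : ∫ t in (0 : ℝ)..x, p t * (w x - w t) =
      (∫ t in (0 : ℝ)..x, p t) * w x - ∫ t in (0 : ℝ)..x, p t * w t := by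
    rw [← intervalIntegral.integral_mul_const, ← intervalIntegral.integral_sub (hp.mul_const _) hpw]
    simp_rw [mul_sub]
  rw [e2]
  ring

/-! ### The Weyl solution built from the Riccati solution -/

section

variable {q : ℝ → ℝ} {Q : ℝ} {κ : ℂ}

lemma integral_Ioi_comp_add_left (f : ℝ → ℂ) (x : ℝ) :
    ∫ t in Ioi (0 : ℝ), f (x + t) = ∫ t in Ioi x, f t := by
  rw [← integral_indicator measurableSet_Ioi, ← integral_indicator measurableSet_Ioi,
    ← integral_add_left_eq_self ((Ioi x).indicator f) x]
  congr 1
  funext t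
  simp [indicator_apply]

lemma intervalIntegrable_of_bound {f : ℝ → ℂ} (hf : Measurable f) {C : ℝ} (hC : ∀ t, ‖f t‖ ≤ C)
    (a b : ℝ) : IntervalIntegrable f volume a b :=
  (intervalIntegrable_const (c := C)).mono_fun hf.aestronglyMeasurable
    (ae_of_all _ fun t => (hC t).trans (le_abs_self C))

lemma norm_riccatiSource_le (hq : Measurable q) (hQ : ∀ x, |q x| ≤ Q) (hκ : 0 < κ.re)
    (h : Q < κ.re ^ 2) (t : ℝ) :
    ‖(q t : ℂ) - riccati q κ t ^ 2‖ ≤ Q + majBound Q κ.re ^ 2 := by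
  refine (norm_sub_le _ _).trans (add_le_add (by simpa using hQ t) ?_)
  rw [norm_pow]
  gcongr
  exact norm_riccati_le hq hQ hκ h t

/-- Shifting `t` by `x` in the integrated Riccati equation gives `n(x) = e^{2κx} ∫_x^∞ e^{-2κt}(q -
n²) dt`: a smooth factor times a primitive, the shape required by the product rule
`primitive_mul_eq`. -/
lemma exists_riccati_factor (hq : Measurable q) (hQ : ∀ x, |q x| ≤ Q) (hκ : 0 < κ.re)
    (h : Q < κ.re ^ 2) : ∃ P : ℝ → ℂ, (∀ x, riccati q κ x = P x * Complex.exp (2 * (x : ℂ) * κ)) ∧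
      (∀ x, 0 ≤ x → P x = P 0 + ∫ t in (0 : ℝ)..x,
        -(Complex.exp (-2 * (t : ℂ) * κ) * ((q t : ℂ) - riccati q κ t ^ 2))) := by
  have hnm := measurable_riccati hq hQ hκ h
  set g : ℝ → ℂ := fun t => Complex.exp (-2 * (t : ℂ) * κ) * ((q t : ℂ) - riccati q κ t ^ 2) with hg
  refine ⟨fun x => ∫ t in Ioi x, g t, fun x => ?_, fun x hx => ?_⟩
  · beta_reduce
    rw [riccati_eq hq hQ hκ h, ← integral_Ioi_comp_add_left g x, ← integral_mul_const]
    congr 1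
    funext t
    simp only [hg]
    rw [cexp_neg_two_add]
    have : Complex.exp (-2 * (x : ℂ) * κ) * Complex.exp (2 * (x : ℂ) * κ) = 1 := by
      rw [← Complex.exp_add]; ring_nf; simp
    linear_combination (-Complex.exp (-2 * (t : ℂ) * κ) *
      ((q (x + t) : ℂ) - riccati q κ (x + t) ^ 2)) * this
  · have hgi : IntegrableOn g (Ioi 0) :=
      integrableOn_cexp_mul hκ (by fun_prop) (norm_riccatiSource_le hq hQ hκ h)
    rw [intervalIntegral.integral_neg]
    have := intervalIntegral.integral_interval_add_Ioi hgi
      (hgi.mono_set (Ioi_subset_Ioi hx))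
    linear_combination this

lemma continuousOn_riccati (hq : Measurable q) (hQ : ∀ x, |q x| ≤ Q) (hκ : 0 < κ.re)
    (h : Q < κ.re ^ 2) : ContinuousOn (riccati q κ) (Ici 0) := by
  have hnm := measurable_riccati hq hQ hκ h
  obtain ⟨P, h1, h2⟩ := exists_riccati_factor hq hQ hκ h
  have hP : ContinuousOn P (Ici 0) := by
    have hi : ∀ b : ℝ, IntervalIntegrable (fun t : ℝ =>
        -(Complex.exp (-2 * (t : ℂ) * κ) * ((q t : ℂ) - riccati q κ t ^ 2))) volume 0 b := fun b =>
      ((intervalIntegrable_of_bound (by fun_prop) (norm_riccatiSource_le hq hQ hκ h)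
        0 b).continuousOn_mul (by fun_prop)).neg
    have hc : ContinuousOn (fun x => P 0 + ∫ t in (0 : ℝ)..x,
        -(Complex.exp (-2 * (t : ℂ) * κ) * ((q t : ℂ) - riccati q κ t ^ 2))) (Ici 0) := by
      refine continuousOn_const.add (Continuous.continuousOn ?_)
      refine intervalIntegral.continuous_primitive (fun a b => (hi a).symm.trans (hi b)) 0
    exact hc.congr fun x hx => h2 x hx
  exact (hP.mul (by fun_prop : Continuous fun x : ℝ =>
    Complex.exp (2 * (x : ℂ) * κ)).continuousOn).congr fun x _ => h1 x

lemma riccati_eq_integral (hq : Measurable q) (hQ : ∀ x, |q x| ≤ Q) (hκ : 0 < κ.re)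
    (h : Q < κ.re ^ 2) {x : ℝ} (hx : 0 ≤ x) : riccati q κ x = riccati q κ 0 +
      ∫ t in (0 : ℝ)..x, (2 * κ * riccati q κ t + riccati q κ t ^ 2 - (q t : ℂ)) := by
  have hnm := measurable_riccati hq hQ hκ h
  obtain ⟨P, h1, h2⟩ := exists_riccati_factor hq hQ hκ h
  have hw : ∀ s : ℝ, HasDerivAt (fun x : ℝ => Complex.exp (2 * (x : ℂ) * κ))
      (2 * κ * Complex.exp (2 * (s : ℂ) * κ)) s := by
    intro s
    have := (((Complex.ofRealCLM.hasDerivAt (x := s)).const_mul (2 : ℂ)).mul_const κ).cexp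
    simpa [mul_comm, mul_left_comm, mul_assoc] using this
  have key := primitive_mul_eq hx (fun s hs => h2 s hs.1)
    (((intervalIntegrable_of_bound (by fun_prop) (norm_riccatiSource_le hq hQ hκ h)
        0 x).continuousOn_mul (by fun_prop)).neg) (fun s _ => (hw s).hasDerivWithinAt)
    (Continuous.continuousOn (by fun_prop))
  rw [← h1, ← h1] at key
  rw [key]
  congr 1
  refine intervalIntegral.integral_congr fun s _ => ?_
  rw [h1 s]
  have : Complex.exp (-2 * (s : ℂ) * κ) * Complex.exp (2 * (s : ℂ) * κ) = 1 := by
    rw [← Complex.exp_add]; ring_nf; simp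
  linear_combination (-((q s : ℂ) - (P s * Complex.exp (2 * (s : ℂ) * κ)) ^ 2)) * this

/-- The Weyl solution obtained from the solution of the Riccati equation. -/
def weylSol (q : ℝ → ℝ) (κ : ℂ) (x : ℝ) : ℂ :=
  Complex.exp (-κ * x - ∫ t in (0 : ℝ)..x, riccati q κ t)

lemma weylSol_ne_zero (x : ℝ) : weylSol q κ x ≠ 0 := Complex.exp_ne_zero _

lemma weylSol_zero : weylSol q κ 0 = 1 := by simp [weylSol]

lemma hasDerivWithinAt_weylSol (hq : Measurable q) (hQ : ∀ x, |q x| ≤ Q) (hκ : 0 < κ.re)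
    (h : Q < κ.re ^ 2) {x : ℝ} (hx : 0 ≤ x) :
    HasDerivWithinAt (weylSol q κ) (-(κ + riccati q κ x) * weylSol q κ x) (Ici 0) x := by
  have hnm := measurable_riccati hq hQ hκ h
  have hnc := continuousOn_riccati hq hQ hκ h
  have hi := intervalIntegrable_of_bound hnm (norm_riccati_le hq hQ hκ h) 0 x
  have h1 : HasDerivWithinAt (fun x => ∫ t in (0 : ℝ)..x, riccati q κ t) (riccati q κ x)
      (Ici 0) x := by
    rcases hx.eq_or_lt with rfl | hx
    · exact intervalIntegral.integral_hasDerivWithinAt_right hi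
        (hnm.stronglyMeasurable.stronglyMeasurableAtFilter)
        ((hnc 0 (mem_Ici.2 le_rfl)).mono Ioi_subset_Ici_self)
    · exact (intervalIntegral.integral_hasDerivAt_right hi
        (hnm.stronglyMeasurable.stronglyMeasurableAtFilter)
        ((hnc x hx.le).continuousAt (Ici_mem_nhds hx))).hasDerivWithinAt
  have h2 : HasDerivWithinAt (fun x : ℝ => -κ * (x : ℂ)) (-κ) (Ici 0) x := by
    simpa using ((Complex.ofRealCLM.hasDerivAt (x := x)).const_mul (-κ)).hasDerivWithinAt
  have := (h2.sub h1).cexp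
  exact this.congr_deriv (by simp only [weylSol, Pi.sub_apply]; ring)

/-- `|∫₀ˣ n| ≤ majBound · x`, and `majBound < Re κ` makes this genuine exponential decay. -/
lemma norm_weylSol_le (hq : Measurable q) (hQ : ∀ x, |q x| ≤ Q) (hκ : 0 < κ.re)
    (h : Q < κ.re ^ 2) {x : ℝ} (hx : 0 ≤ x) :
    ‖weylSol q κ x‖ ≤ Real.exp (-(κ.re - majBound Q κ.re) * x) := by
  rw [weylSol, Complex.norm_exp, Real.exp_le_exp]
  have h1 : ‖∫ t in (0 : ℝ)..x, riccati q κ t‖ ≤ majBound Q κ.re * |x - 0| :=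
    intervalIntegral.norm_integral_le_of_norm_le_const fun t _ => norm_riccati_le hq hQ hκ h t
  have h2 := (abs_le.1 ((Complex.abs_re_le_norm _).trans h1)).1
  rw [sub_zero, abs_of_nonneg hx] at h2
  simp only [Complex.sub_re, Complex.mul_re, Complex.neg_re, Complex.ofReal_re, Complex.neg_im,
    Complex.ofReal_im, mul_zero, sub_zero]
  linarith

lemma continuousOn_weylSol (hq : Measurable q) (hQ : ∀ x, |q x| ≤ Q) (hκ : 0 < κ.re)
    (h : Q < κ.re ^ 2) : ContinuousOn (weylSol q κ) (Ici 0) := fun _ hx =>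
  (hasDerivWithinAt_weylSol hq hQ hκ h hx).continuousWithinAt

lemma memLp_weylSol (hq : Measurable q) (hQ : ∀ x, |q x| ≤ Q) (hκ : 0 < κ.re)
    (h : Q < κ.re ^ 2) : MemLp (weylSol q κ) 2 (volume.restrict (Ioi (0 : ℝ))) := by
  have hm : AEStronglyMeasurable (weylSol q κ) (volume.restrict (Ioi (0 : ℝ))) :=
    ((continuousOn_weylSol hq hQ hκ h).mono Ioi_subset_Ici_self).aestronglyMeasurable
      measurableSet_Ioi
  refine (memLp_two_iff_integrable_sq_norm hm).2 ?_
  have hpos : 0 < 2 * (κ.re - majBound Q κ.re) := by linarith [majBound_lt h]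
  refine (exp_neg_integrableOn_Ioi 0 hpos).mono' (hm.norm.pow 2) ?_
  filter_upwards [ae_restrict_mem measurableSet_Ioi] with x hx
  rw [norm_pow, norm_norm]
  refine (pow_le_pow_left₀ (norm_nonneg _) (norm_weylSol_le hq hQ hκ h (le_of_lt hx)) 2).trans ?_
  rw [← Real.exp_nat_mul]
  exact Real.exp_le_exp.2 (le_of_eq (by push_cast; ring))

lemma isWeylSolution_weylSol (hq : Measurable q) (hQ : ∀ x, |q x| ≤ Q) (hκ : 0 < κ.re)
    (h : Q < κ.re ^ 2) : IsWeylSolution q (-κ ^ 2) (weylSol q κ)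
      fun x => -(κ + riccati q κ x) * weylSol q κ x where
  hasDeriv x hx := hasDerivWithinAt_weylSol hq hQ hκ h hx
  equation x hx := by
    have hnm := measurable_riccati hq hQ hκ h
    have hQ0 : 0 ≤ Q := (abs_nonneg _).trans (hQ 0)
    have hsub : Icc 0 x ⊆ Ici 0 := fun y hy => hy.1
    have hp : IntervalIntegrable (fun t => -(2 * κ * riccati q κ t + riccati q κ t ^ 2 - (q t : ℂ)))
        volume 0 x := by
      refine intervalIntegrable_of_bound (by fun_prop)
        (C := 2 * ‖κ‖ * majBound Q κ.re + majBound Q κ.re ^ 2 + Q) (fun t => ?_) 0 x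
      have hn := norm_riccati_le hq hQ hκ h t
      rw [norm_neg]
      refine (norm_sub_le _ _).trans (add_le_add ((norm_add_le _ _).trans (add_le_add ?_ ?_)) ?_)
      · rw [norm_mul, norm_mul]
        simpa using by gcongr
      · rw [norm_pow]; gcongr
      · simpa using hQ t
    -- With `P = -(κ + n)` and `u' = Pu`, the product rule gives `u'' = (P' + P²)u`, and `-(2κn + n²
    -- - q) + (κ + n)² = q + κ²`.
    have key := primitive_mul_eq (P := fun x => -(κ + riccati q κ x)) hx (fun s hs => by
        rw [intervalIntegral.integral_neg, riccati_eq_integral hq hQ hκ h hs.1]; ring) hp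
      (fun s hs => hasDerivWithinAt_weylSol hq hQ hκ h hs.1)
      (((continuousOn_const.add (continuousOn_riccati hq hQ hκ h)).neg.mul
        (continuousOn_weylSol hq hQ hκ h)).mono hsub)
    rw [key]
    congr 1
    refine intervalIntegral.integral_congr fun s _ => ?_
    ring
  nonzero := ⟨0, (mem_Ici.2 le_rfl), weylSol_ne_zero 0⟩
  memLp := memLp_weylSol hq hQ hκ h

/-! ### Uniqueness of the Weyl solution up to a factor -/

lemma IsWeylSolution.continuousOn {z : ℂ} {v v' : ℝ → ℂ} (hv : IsWeylSolution q z v v') :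
    ContinuousOn v (Ici 0) := fun x hx => (hv.hasDeriv x hx).continuousWithinAt

lemma IsWeylSolution.intervalIntegrable {z : ℂ} {v v' : ℝ → ℂ} (hv : IsWeylSolution q z v v')
    (hq : Measurable q) (hQ : ∀ x, |q x| ≤ Q) {x : ℝ} (hx : 0 ≤ x) :
    IntervalIntegrable (fun t => ((q t : ℂ) - z) * v t) volume 0 x := by
  refine (intervalIntegrable_of_bound (by fun_prop) (C := Q + ‖z‖) (fun t => ?_) 0 x).mul_continuousOn
    (hv.continuousOn.mono ?_)
  · exact (norm_sub_le _ _).trans (add_le_add (by simpa using hQ t) le_rfl)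
  · rw [uIcc_of_le hx]; exact fun y hy => hy.1

lemma IsWeylSolution.continuousOn_deriv {z : ℂ} {v v' : ℝ → ℂ} (hv : IsWeylSolution q z v v')
    (hq : Measurable q) (hQ : ∀ x, |q x| ≤ Q) (x : ℝ) : ContinuousOn v' (Icc 0 x) := by
  rcases lt_or_ge x 0 with hx | hx
  · rw [Icc_eq_empty hx.not_ge]; exact continuousOn_empty _
  have := intervalIntegral.continuousOn_primitive_interval' (μ := volume) (a := 0)
    (hv.intervalIntegrable hq hQ hx) left_mem_uIcc
  rw [uIcc_of_le hx] at this
  exact (continuousOn_const.add this).congr fun s hs => hv.equation s hs.1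

lemma IsWeylSolution.wronskian_eq {z : ℂ} {u u' v v' : ℝ → ℂ} (hu : IsWeylSolution q z u u')
    (hv : IsWeylSolution q z v v') (hq : Measurable q) (hQ : ∀ x, |q x| ≤ Q) {x : ℝ} (hx : 0 ≤ x) :
    v' x * u x - u' x * v x = v' 0 * u 0 - u' 0 * v 0 := by
  rw [primitive_mul_eq hx (fun s hs => hv.equation s hs.1) (hv.intervalIntegrable hq hQ hx)
      (fun s hs => hu.hasDeriv s hs.1) (hu.continuousOn_deriv hq hQ x),
    primitive_mul_eq hx (fun s hs => hu.equation s hs.1) (hu.intervalIntegrable hq hQ hx)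
      (fun s hs => hv.hasDeriv s hs.1) (hv.continuousOn_deriv hq hQ x)]
  have : ∫ s in (0 : ℝ)..x, (((q s : ℂ) - z) * v s * u s + v' s * u' s) =
      ∫ s in (0 : ℝ)..x, (((q s : ℂ) - z) * u s * v s + u' s * v' s) :=
    intervalIntegral.integral_congr fun s _ => by ring
  rw [this]
  ring

/-- Nothing is assumed about `v'` at infinity, so `v'` is eliminated: `(uv)' = W + 2u'v`.
Integrating, `xW` differs from `u(x)v(x)` by a bounded amount because `u'v` is integrable; `W ≠ 0`
would force `|uv|` to grow linearly, although `uv` is integrable. -/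
lemma IsWeylSolution.wronskian_eq_zero {z : ℂ} {u u' v v' : ℝ → ℂ} (hu : IsWeylSolution q z u u')
    (hv : IsWeylSolution q z v v') (hq : Measurable q) (hQ : ∀ x, |q x| ≤ Q)
    (hu' : MemLp u' 2 (volume.restrict (Ioi (0 : ℝ)))) : v' 0 * u 0 - u' 0 * v 0 = 0 := by
  set W := v' 0 * u 0 - u' 0 * v 0 with hW
  by_contra hne
  have h1 : IntegrableOn (fun x => u' x * v x) (Ioi 0) := hu'.integrable_mul hv.memLp
  have h2 : IntegrableOn (fun x => u x * v x) (Ioi 0) := hu.memLp.integrable_mul hv.memLp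
  set K := ∫ x in Ioi (0 : ℝ), ‖u' x * v x‖
  have hmain : ∀ x : ℝ, 0 ≤ x → ‖W‖ * x ≤ ‖u x * v x‖ + (‖u 0 * v 0‖ + 2 * K) := by
    intro x hx
    have hcu := hu.continuousOn_deriv hq hQ x
    have hc : Icc 0 x ⊆ Ici 0 := fun y hy => hy.1
    have hi : IntervalIntegrable (fun s => u' s * v s) volume 0 x :=
      ContinuousOn.intervalIntegrable (by
        rw [uIcc_of_le hx]; exact hcu.mul (hv.continuousOn.mono hc))
    have hFTC : ∫ s in (0 : ℝ)..x, (W + 2 * (u' s * v s)) = u x * v x - u 0 * v 0 := by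
      refine intervalIntegral.integral_eq_sub_of_hasDeriv_right_of_le (f := fun s => u s * v s) hx
        ((hu.continuousOn.mul hv.continuousOn).mono hc) (fun s hs => ?_)
        (intervalIntegrable_const.add (hi.const_mul 2))
      have hd := (((hu.hasDeriv s hs.1.le).mul (hv.hasDeriv s hs.1.le))).mono
        (fun y hy => (hs.1.le.trans (le_of_lt hy)) : Ioi s ⊆ Ici 0)
      refine hd.congr_deriv ?_
      have := hu.wronskian_eq hv hq hQ hs.1.le
      rw [← hW] at this
      linear_combination this
    rw [intervalIntegral.integral_add intervalIntegrable_const (hi.const_mul 2),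
      intervalIntegral.integral_const, intervalIntegral.integral_const_mul] at hFTC
    have hK : ‖∫ s in (0 : ℝ)..x, u' s * v s‖ ≤ K := by
      rw [intervalIntegral.integral_of_le hx]
      exact (norm_integral_le_integral_norm _).trans (setIntegral_mono_set h1.norm
        (ae_of_all _ fun _ => norm_nonneg _) (ae_of_all _ fun y hy => hy.1))
    have e : (x : ℂ) * W = u x * v x - (u 0 * v 0 + 2 * ∫ s in (0 : ℝ)..x, u' s * v s) := by
      simp only [sub_zero, Complex.real_smul] at hFTC
      linear_combination hFTC
    calc ‖W‖ * x = ‖(x : ℂ) * W‖ := by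
          rw [norm_mul, Complex.norm_real, Real.norm_of_nonneg hx, mul_comm]
      _ ≤ ‖u x * v x‖ + (‖u 0 * v 0‖ + 2 * K) := by
          rw [e]
          refine (norm_sub_le _ _).trans (add_le_add le_rfl ((norm_add_le _ _).trans
            (add_le_add le_rfl ?_)))
          rw [norm_mul]
          simpa using hK
  have hWpos : 0 < ‖W‖ := norm_pos_iff.2 hne
  have hK0 : 0 ≤ K := integral_nonneg fun _ => norm_nonneg _
  -- Beyond this point the estimate `hmain` forces `|uv| ≥ 1`.
  set X := (1 + (‖u 0 * v 0‖ + 2 * K)) / ‖W‖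
  have hX0 : 0 ≤ X := by positivity
  have hone : IntegrableOn (fun _ : ℝ => (1 : ℝ)) (Ioi X) := by
    refine Integrable.mono (h2.mono_set (Ioi_subset_Ioi hX0)) (by fun_prop) ?_
    filter_upwards [ae_restrict_mem measurableSet_Ioi] with x hx
    have hx' : X < x := hx
    have := hmain x (hX0.trans hx'.le)
    have h3 : 1 + (‖u 0 * v 0‖ + 2 * K) < x * ‖W‖ := (div_lt_iff₀ hWpos).1 hx'
    rw [norm_one]
    linarith [mul_comm x ‖W‖]
  rw [integrableOn_const_iff] at hone
  simp at hone

/-- The derivative of `v/u` is the Wronskian divided by `u²`, hence zero. -/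
lemma IsWeylSolution.eq_const_mul {z : ℂ} {u u' v v' : ℝ → ℂ} (hu : IsWeylSolution q z u u')
    (hv : IsWeylSolution q z v v') (hq : Measurable q) (hQ : ∀ x, |q x| ≤ Q)
    (hu' : MemLp u' 2 (volume.restrict (Ioi (0 : ℝ)))) (hne : ∀ x, 0 ≤ x → u x ≠ 0) {x : ℝ}
    (hx : 0 ≤ x) : v x / u x = v 0 / u 0 := by
  have hW := hu.wronskian_eq_zero hv hq hQ hu'
  have hc : Icc 0 x ⊆ Ici 0 := fun y hy => hy.1
  refine constant_of_has_deriv_right_zero (f := fun x => v x / u x) ?_ (fun s hs => ?_) x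
    ⟨hx, le_rfl⟩
  · exact (hv.continuousOn.mono hc).div (hu.continuousOn.mono hc) fun s hs => hne s hs.1
  · have hd := (((hv.hasDeriv s hs.1).div (hu.hasDeriv s hs.1) (hne s hs.1))).mono
      (Ici_subset_Ici.2 hs.1)
    refine hd.congr_deriv ?_
    have := hu.wronskian_eq hv hq hQ hs.1
    rw [hW] at this
    rw [div_eq_zero_iff]
    left
    linear_combination this

lemma memLp_deriv_weylSol (hq : Measurable q) (hQ : ∀ x, |q x| ≤ Q) (hκ : 0 < κ.re)
    (h : Q < κ.re ^ 2) : MemLp (fun x => -(κ + riccati q κ x) * weylSol q κ x) 2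
      (volume.restrict (Ioi (0 : ℝ))) := by
  have hnm := measurable_riccati hq hQ hκ h
  have hsol := memLp_weylSol hq hQ hκ h
  refine hsol.of_le_mul (c := ‖κ‖ + majBound Q κ.re) ?_ (ae_of_all _ fun x => ?_)
  · exact (by fun_prop : Measurable fun x => -(κ + riccati q κ x)).aestronglyMeasurable.mul hsol.1
  · rw [norm_mul, norm_neg]
    gcongr
    exact (norm_add_le _ _).trans (add_le_add le_rfl (norm_riccati_le hq hQ hκ h x))

/-- A Weyl solution is a multiple of `weylSol`, so `v 0 = 0` would make it vanish identically; the
zero Wronskian at `0` then fixes the quotient. In particular the choice made in `weylM` is harmless.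
-/
lemma IsWeylSolution.quotient_eq (hq : Measurable q) (hQ : ∀ x, |q x| ≤ Q) (hκ : 0 < κ.re)
    (h : Q < κ.re ^ 2) {v v' : ℝ → ℂ} (hv : IsWeylSolution q (-κ ^ 2) v v') :
    v 0 ≠ 0 ∧ v' 0 / v 0 = -κ - riccati q κ 0 := by
  have hu := isWeylSolution_weylSol hq hQ hκ h
  have hu' := memLp_deriv_weylSol hq hQ hκ h
  have hv0 : v 0 ≠ 0 := by
    intro h0
    obtain ⟨x, hx, hvx⟩ := hv.nonzero
    have := hu.eq_const_mul hv hq hQ hu' (fun x _ => weylSol_ne_zero x) hx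
    rw [h0, zero_div, div_eq_zero_iff] at this
    exact this.elim hvx (weylSol_ne_zero x)
  refine ⟨hv0, ?_⟩
  have hW := hu.wronskian_eq_zero hv hq hQ hu'
  rw [weylSol_zero] at hW
  rw [div_eq_iff hv0]
  linear_combination hW

lemma IsWeylSolution.congr {q₁ : ℝ → ℝ} {z : ℂ} {u u' : ℝ → ℂ} (hu : IsWeylSolution q z u u')
    (hqq : q =ᵐ[volume.restrict (Ioi 0)] q₁) : IsWeylSolution q₁ z u u' where
  hasDeriv := hu.hasDeriv
  equation x hx := by
    rw [hu.equation x hx]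
    congr 1
    refine intervalIntegral.integral_congr_ae ?_
    rw [uIoc_of_le hx]
    filter_upwards [(ae_restrict_iff' measurableSet_Ioi).1 hqq] with t ht hmem
    rw [ht hmem.1]
  nonzero := hu.nonzero
  memLp := hu.memLp

end

/-! ### Laplace transforms: analyticity, tails, uniqueness -/

lemma integrable_laplaceIntegrand {f : ℝ → ℝ} {c : ℝ} (hf0 : ∀ α < 0, f α = 0)
    (hfm : AEStronglyMeasurable f) (hf : Integrable fun α => f α * Real.exp (-2 * α * c)) {κ : ℂ}
    (hκ : c ≤ κ.re) : Integrable fun α : ℝ => (f α : ℂ) * Complex.exp (-2 * (α : ℂ) * κ) := by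
  refine hf.mono ((Complex.continuous_ofReal.comp_aestronglyMeasurable hfm).mul
    (measurable_cexp_neg_two κ).aestronglyMeasurable) (ae_of_all _ fun α => ?_)
  rw [norm_mul, norm_mul, norm_cexp_neg_two, Complex.norm_real, Real.norm_of_nonneg
    (Real.exp_nonneg _)]
  rcases lt_or_ge α 0 with h | h
  · simp [hf0 α h]
  · gcongr ‖f α‖ * Real.exp ?_
    nlinarith

lemma differentiableAt_laplace {f : ℝ → ℝ} {c : ℝ} (hf0 : ∀ α < 0, f α = 0)
    (hfm : AEStronglyMeasurable f) (hf : Integrable fun α => f α * Real.exp (-2 * α * c)) {κ : ℂ}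
    (hκ : c < κ.re) : DifferentiableAt ℂ (laplace f) κ := by
  set δ := (κ.re - c) / 2 with hδ
  have hδ0 : 0 < δ := by rw [hδ]; linarith
  have hre : ∀ w ∈ Metric.ball κ δ, c + δ ≤ w.re := by
    intro w hw
    have h1 := (abs_le.1 ((Complex.abs_re_le_norm (w - κ)).trans (mem_ball_iff_norm.1 hw).le)).1
    rw [Complex.sub_re] at h1
    linarith
  have hm : AEStronglyMeasurable (fun α : ℝ => (f α : ℂ)) :=
    Complex.continuous_ofReal.comp_aestronglyMeasurable hfm
  have key := hasDerivAt_integral_of_dominated_loc_of_deriv_le (μ := volume) (𝕜 := ℂ)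
    (F := fun w (α : ℝ) => (f α : ℂ) * Complex.exp (-2 * (α : ℂ) * w))
    (F' := fun w (α : ℝ) => (f α : ℂ) * (Complex.exp (-2 * (α : ℂ) * w) * (-2 * (α : ℂ))))
    -- Differentiation costs a factor `2α`, absorbed by the spare decay: `2α e^{-2αδ} ≤ 1/δ`.
    (x₀ := κ) (s := Metric.ball κ δ) (bound := fun α => ‖f α * Real.exp (-2 * α * c)‖ * δ⁻¹)
    (Metric.ball_mem_nhds _ hδ0)
    (Eventually.of_forall fun w => hm.mul (measurable_cexp_neg_two w).aestronglyMeasurable)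
    (integrable_laplaceIntegrand hf0 hfm hf hκ.le)
    (hm.mul (by fun_prop)) (ae_of_all _ fun α w hw => ?_) (hf.norm.mul_const _)
    (ae_of_all _ fun α w _ => ?_)
  · exact key.2.differentiableAt
  · rcases lt_or_ge α 0 with h | h
    · simp [hf0 α h]
    · have h1 := hre w hw
      rw [norm_mul, norm_mul, norm_cexp_neg_two, Complex.norm_real, norm_mul (f α) (Real.exp _),
        mul_assoc ‖f α‖, Real.norm_of_nonneg (Real.exp_nonneg _)]
      gcongr ‖f α‖ * ?_
      have h2 : ‖-2 * (α : ℂ)‖ = 2 * α := by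
        rw [norm_mul, Complex.norm_real, Real.norm_of_nonneg h]; simp
      rw [h2]
      have h3 : 2 * α * δ ≤ Real.exp (2 * α * δ) := by
        linarith [Real.add_one_le_exp (2 * α * δ)]
      have h4 : Real.exp (-2 * α * w.re) ≤ Real.exp (-2 * α * c) * Real.exp (-(2 * α * δ)) := by
        rw [← Real.exp_add, Real.exp_le_exp]; nlinarith
      calc Real.exp (-2 * α * w.re) * (2 * α)
          ≤ (Real.exp (-2 * α * c) * Real.exp (-(2 * α * δ))) * (2 * α) := by gcongr
        _ = Real.exp (-2 * α * c) * (Real.exp (-(2 * α * δ)) * (2 * α * δ)) * δ⁻¹ := by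
            field_simp
        _ ≤ Real.exp (-2 * α * c) * (Real.exp (-(2 * α * δ)) * Real.exp (2 * α * δ)) * δ⁻¹ := by
            gcongr
        _ = Real.exp (-2 * α * c) * δ⁻¹ := by rw [← Real.exp_add]; simp
  · exact (((hasDerivAt_id w).const_mul (-2 * (α : ℂ))).cexp.const_mul (f α : ℂ)).congr_deriv
      (by simp)

lemma norm_laplace_tail_le {f : ℝ → ℝ} {a c : ℝ} (hf0 : ∀ α ≤ a, f α = 0)
    (hf : Integrable fun α => f α * Real.exp (-2 * α * c)) {κ : ℂ} (hκ : c ≤ κ.re) :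
    ‖laplace f κ‖ ≤
      Real.exp (-2 * a * (κ.re - c)) * ∫ α, ‖f α * Real.exp (-2 * α * c)‖ := by
  rw [← integral_const_mul]
  refine norm_integral_le_of_norm_le (hf.norm.const_mul _) (ae_of_all _ fun α => ?_)
  rw [norm_mul, norm_mul, norm_cexp_neg_two, Complex.norm_real,
    Real.norm_of_nonneg (Real.exp_nonneg _)]
  rcases le_or_gt α a with h | h
  · simp [hf0 α h]
  · rw [mul_left_comm, ← Real.exp_add]
    gcongr ‖f α‖ * Real.exp ?_
    nlinarith

lemma laplace_conj (f : ℝ → ℝ) (κ : ℂ) :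
    laplace f (starRingEnd ℂ κ) = starRingEnd ℂ (laplace f κ) := by
  rw [laplace, laplace, ← integral_conj]
  congr 1
  funext α
  rw [map_mul, Complex.conj_ofReal, ← Complex.exp_conj]
  simp [map_ofNat]

/-- A real function is determined almost everywhere by its Fourier transform. -/
lemma ae_eq_zero_of_laplace_eq_zero {f : ℝ → ℝ} (hf : Integrable f)
    (h : ∀ κ : ℂ, laplace f κ = 0) : f =ᵐ[volume] 0 := by
  have hp : Integrable fun α => max (f α) 0 := hf.pos_part
  have hn : Integrable fun α => max (-f α) 0 := hf.neg_part
  have hpm : AEMeasurable fun α => ENNReal.ofReal (f α) := hf.aestronglyMeasurable.aemeasurable.ennreal_ofReal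
  have hnm : AEMeasurable fun α => ENNReal.ofReal (-f α) :=
    hf.aestronglyMeasurable.aemeasurable.neg.ennreal_ofReal
  have hpf : ∫⁻ α, ENNReal.ofReal (f α) ≠ ⊤ := hf.lintegral_lt_top.ne
  have hnf : ∫⁻ α, ENNReal.ofReal (-f α) ≠ ⊤ := hf.neg.lintegral_lt_top.ne
  set μ := volume.withDensity fun α => ENNReal.ofReal (f α) with hμ
  set ν := volume.withDensity fun α => ENNReal.ofReal (-f α) with hν
  have : IsFiniteMeasure μ := isFiniteMeasure_withDensity hpf
  have : IsFiniteMeasure ν := isFiniteMeasure_withDensity hnf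
  have hμν : μ = ν := by
    refine Measure.ext_of_charFun ?_
    funext t
    rw [charFun_apply_real, charFun_apply_real, hμ, hν,
      integral_withDensity_eq_integral_toReal_smul₀ hpm (ae_of_all _ fun _ => ENNReal.ofReal_lt_top),
      integral_withDensity_eq_integral_toReal_smul₀ hnm (ae_of_all _ fun _ => ENNReal.ofReal_lt_top)]
    have hb : ∀ g : ℝ → ℝ, Integrable g →
        Integrable fun α => g α • Complex.exp (t * α * Complex.I) := by
      intro g hg
      simp_rw [Complex.real_smul]
      refine hg.ofReal.mul_bdd (c := 1) (by fun_prop) (ae_of_all _ fun α => ?_)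
      rw [Complex.norm_exp]
      simp
    simp only [ENNReal.toReal_ofReal']
    -- The positive and negative parts are densities of finite measures. Their characteristic
    -- functions at `t` differ by the transform at `κ = -it/2`, which vanishes.
    rw [← sub_eq_zero, ← integral_sub (hb _ hp) (hb _ hn), ← h (-(t / 2) * Complex.I), laplace]
    congr 1
    funext α
    rw [← sub_smul, Complex.real_smul]
    have e1 : max (f α) 0 - max (-f α) 0 = f α := by
      rcases le_total (f α) 0 with h | h
      · rw [max_eq_right h, max_eq_left (by linarith)]; ring
      · rw [max_eq_left h, max_eq_right (by linarith)]; ring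
    rw [e1]
    ring_nf
  have h1 := (withDensity_eq_iff hpm hnm hpf).1 hμν
  filter_upwards [h1] with α hα
  rcases le_total (f α) 0 with h | h
  · rw [ENNReal.ofReal_of_nonpos h, eq_comm, ENNReal.ofReal_eq_zero] at hα
    exact le_antisymm h (neg_nonpos.1 hα)
  · rw [ENNReal.ofReal_of_nonpos (by linarith : -f α ≤ 0), ENNReal.ofReal_eq_zero] at hα
    exact le_antisymm hα h

/-- An entire function of exponential type that is bounded on the four diagonal rays is bounded. -/
lemma norm_le_of_bounded_on_diagonals {G : ℂ → ℂ} (hG : Differentiable ℂ G) {K B C : ℝ}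
    (hexp : ∀ z, ‖G z‖ ≤ K * Real.exp (B * ‖z‖))
    (h1 : ∀ r : ℝ, 0 ≤ r → ‖G (r * (1 - Complex.I))‖ ≤ C)
    (h2 : ∀ r : ℝ, 0 ≤ r → ‖G (r * (1 + Complex.I))‖ ≤ C)
    (h3 : ∀ r : ℝ, 0 ≤ r → ‖G (r * (-1 + Complex.I))‖ ≤ C)
    (h4 : ∀ r : ℝ, 0 ≤ r → ‖G (r * (-1 - Complex.I))‖ ≤ C) (z : ℂ) : ‖G z‖ ≤ C := by
  have key : ∀ ω : ℂ, (∀ r : ℝ, 0 ≤ r → ‖G (r * ω)‖ ≤ C) →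
      (∀ r : ℝ, 0 ≤ r → ‖G (r * (Complex.I * ω))‖ ≤ C) →
      ∀ w : ℂ, 0 ≤ w.re → 0 ≤ w.im → ‖G (w * ω)‖ ≤ C := by
    intro ω ha hb w hre him
    -- Each sector between neighbouring diagonals is a rotated quadrant, where growth of order `1 <
    -- 2` is admissible.
    refine PhragmenLindelof.quadrant_I (f := fun w => G (w * ω)) (C := C)
      (hG.comp (differentiable_id.mul_const ω)).diffContOnCl ⟨1, by norm_num, B * ‖ω‖, ?_⟩ ha
      (fun x hx => ?_) hre him
    · refine Asymptotics.IsBigO.of_bound K (Eventually.of_forall fun w => ?_)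
      refine (hexp _).trans (le_of_eq ?_)
      rw [Real.norm_of_nonneg (Real.exp_nonneg _), norm_mul, Real.rpow_one]
      ring_nf
    · have := hb x hx
      rwa [← mul_assoc] at this
  have hdecomp : ∀ ω w : ℂ, w * ω = z → (∀ r : ℝ, 0 ≤ r → ‖G (r * ω)‖ ≤ C) →
      (∀ r : ℝ, 0 ≤ r → ‖G (r * (Complex.I * ω))‖ ≤ C) → 0 ≤ w.re → 0 ≤ w.im → ‖G z‖ ≤ C := by
    rintro ω w rfl ha hb hre him
    exact key ω ha hb w hre him
  have hI := Complex.I_mul_I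
  have e1 : Complex.I * (1 - Complex.I) = 1 + Complex.I := by linear_combination -hI
  have e2 : Complex.I * (1 + Complex.I) = -1 + Complex.I := by linear_combination hI
  have e3 : Complex.I * (-1 + Complex.I) = -1 - Complex.I := by linear_combination hI
  have e4 : Complex.I * (-1 - Complex.I) = 1 - Complex.I := by linear_combination -hI
  rcases le_total 0 (z.re - z.im) with hs | hs <;> rcases le_total 0 (z.re + z.im) with ht | ht
  · exact hdecomp (1 - Complex.I) (⟨(z.re - z.im) / 2, (z.re + z.im) / 2⟩)
      (by apply Complex.ext <;> simp <;> ring) h1 (by rwa [e1]) (div_nonneg hs zero_le_two)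
      (div_nonneg ht zero_le_two)
  · exact hdecomp (-1 - Complex.I) (⟨-(z.re + z.im) / 2, (z.re - z.im) / 2⟩)
      (by apply Complex.ext <;> simp <;> ring) h4 (by rwa [e4])
      (by change 0 ≤ -(z.re + z.im) / 2; linarith) (div_nonneg hs zero_le_two)
  · exact hdecomp (1 + Complex.I) (⟨(z.re + z.im) / 2, -(z.re - z.im) / 2⟩)
      (by apply Complex.ext <;> simp <;> ring) h2 (by rwa [e2]) (div_nonneg ht zero_le_two)
      (by change 0 ≤ -(z.re - z.im) / 2; linarith)
  · exact hdecomp (-1 + Complex.I) (⟨-(z.re - z.im) / 2, -(z.re + z.im) / 2⟩)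
      (by apply Complex.ext <;> simp <;> ring) h3 (by rwa [e3])
      (by change 0 ≤ -(z.re - z.im) / 2; linarith)
      (by change 0 ≤ -(z.re + z.im) / 2; linarith)

/-- A Laplace transform over `(0, b)` that decays like `e^{-2bκ}` along the ray `arg κ = -π/4`
vanishes identically. -/
lemma laplace_eq_zero_of_bound {f : ℝ → ℝ} {b : ℝ} (hf : Integrable f)
    (hf0 : ∀ α, α ∉ Ioc 0 b → f α = 0) {C r₀ : ℝ}
    (hC : ∀ r : ℝ, r₀ ≤ r → ‖laplace f (r * (1 - Complex.I))‖ ≤ C * Real.exp (-2 * b * r)) (κ : ℂ) :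
    laplace f κ = 0 := by
  -- `G(κ) = ∫ f(α) e^{2(b-α)κ} dα` with `b - α ≥ 0` on the support is bounded on the left half
  -- plane. The hypothesis bounds it on the ray `1 - i`, and reality of `f` on `1 + i`. So the
  -- entire function `G` is bounded, hence constant.
  set G : ℂ → ℂ := fun κ => Complex.exp (2 * b * κ) * laplace f κ with hG
  have hint : ∀ c : ℝ, Integrable fun α => f α * Real.exp (-2 * α * c) := by
    intro c
    have hfi : Integrable ((Ioc 0 b).indicator f) := by
      rwa [indicator_eq_self.2 fun α hα => by_contra fun h => hα (hf0 α h)]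
    have h1 : IntegrableOn (fun α => f α * Real.exp (-2 * α * c)) (Icc 0 b) :=
      hf.integrableOn.mul_continuousOn (by fun_prop) isCompact_Icc
    refine (integrableOn_iff_integrable_of_support_subset fun α hα => ?_).1 h1
    by_contra h
    exact hα (by dsimp only; rw [hf0 α fun h' => h (Ioc_subset_Icc_self h'), zero_mul])
  have hneg : ∀ α < 0, f α = 0 := fun α hα => hf0 α fun h => hα.not_gt h.1
  have hLd : Differentiable ℂ (laplace f) := fun κ =>
    differentiableAt_laplace hneg hf.1 (hint (κ.re - 1)) (by linarith)
  have hGd : Differentiable ℂ G := by fun_prop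
  have hGeq : ∀ κ, G κ = ∫ α, (f α : ℂ) * Complex.exp (2 * (b - α) * κ) := by
    intro κ
    simp only [hG, laplace]
    rw [← integral_const_mul]
    congr 1
    funext α
    rw [mul_left_comm, ← Complex.exp_add]
    ring_nf
  have hGn : ∀ κ (D : ℝ), (∀ α ∈ Ioc 0 b, 2 * (b - α) * κ.re ≤ D) →
      ‖G κ‖ ≤ (∫ α, ‖f α‖) * Real.exp D := by
    intro κ D hD
    rw [hGeq, ← integral_mul_const]
    refine norm_integral_le_of_norm_le (hf.norm.mul_const _) (ae_of_all _ fun α => ?_)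
    by_cases hα : α ∈ Ioc 0 b
    · rw [norm_mul, Complex.norm_real, Complex.norm_exp]
      gcongr
      refine le_trans (le_of_eq ?_) (hD α hα)
      simp [Complex.mul_re]
    · simp [hf0 α hα]
  have hexp : ∀ z, ‖G z‖ ≤ (∫ α, ‖f α‖) * Real.exp ((2 * b) * ‖z‖) := by
    refine fun z => hGn z _ fun α hα => ?_
    have h1 := Complex.re_le_norm z
    have h2 : 0 ≤ b - α := sub_nonneg.2 hα.2
    have h3 := norm_nonneg z
    nlinarith [hα.1, mul_nonneg h2 (sub_nonneg.2 h1), mul_nonneg hα.1.le h3]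
  have hleft : ∀ z : ℂ, z.re ≤ 0 → ‖G z‖ ≤ ∫ α, ‖f α‖ := by
    intro z hz
    refine (hGn z 0 fun α hα => ?_).trans (by simp)
    have h2 : 0 ≤ b - α := sub_nonneg.2 hα.2
    nlinarith
  obtain ⟨C', hC'⟩ : ∃ C', ∀ r : ℝ, 0 ≤ r → ‖G (r * (1 - Complex.I))‖ ≤ C' := by
    obtain ⟨C₁, hC₁⟩ := (isCompact_Icc (a := 0) (b := r₀)).exists_bound_of_continuousOn
      (f := fun r : ℝ => G (r * (1 - Complex.I)))
      (hGd.continuous.comp (by fun_prop)).continuousOn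
    refine ⟨max C C₁, fun r hr => ?_⟩
    rcases le_total r₀ r with h | h
    · refine le_trans ?_ (le_max_left _ _)
      have e : ‖Complex.exp (2 * b * (r * (1 - Complex.I)))‖ = Real.exp (2 * b * r) := by
        rw [Complex.norm_exp]; simp
      simp only [hG]
      rw [norm_mul, e]
      calc _ ≤ Real.exp (2 * b * r) * (C * Real.exp (-2 * b * r)) := by gcongr; exact hC r h
        _ = C := by rw [mul_left_comm, ← Real.exp_add]; ring_nf; simp
    · exact (hC₁ r ⟨hr, h⟩).trans (le_max_right _ _)
  have hconj : ∀ z, ‖G (starRingEnd ℂ z)‖ = ‖G z‖ := by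
    intro z
    simp only [hG]
    rw [norm_mul, norm_mul, laplace_conj, Complex.norm_conj, Complex.norm_exp, Complex.norm_exp]
    simp
  have hbd := norm_le_of_bounded_on_diagonals hGd (C := max C' (∫ α, ‖f α‖)) hexp
    (fun r hr => (hC' r hr).trans (le_max_left _ _))
    (fun r hr => by
      rw [← hconj]
      have : starRingEnd ℂ (r * (1 + Complex.I)) = r * (1 - Complex.I) := by
        simp [sub_eq_add_neg]
      rw [this]
      exact (hC' r hr).trans (le_max_left _ _))
    (fun r hr => (hleft _ (by simpa using hr)).trans (le_max_right _ _))
    (fun r hr => (hleft _ (by simpa using hr)).trans (le_max_right _ _))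
  have hconst : ∀ z, G z = G 0 := fun z =>
    hGd.apply_eq_apply_of_bounded (isBounded_iff_forall_norm_le.2
      ⟨_, by rintro _ ⟨w, rfl⟩; exact hbd w⟩) z 0
  -- The constant is zero: along the negative axis the integrand tends to `0` except possibly at the
  -- null point `α = b`.
  have hlim : Tendsto (fun t : ℝ => G (-t)) atTop (𝓝 (∫ _ : ℝ, (0 : ℂ))) := by
    simp_rw [hGeq]
    refine tendsto_integral_filter_of_dominated_convergence (fun α => ‖f α‖)
      (Eventually.of_forall fun t => ?_) ?_ hf.norm ?_
    · exact (Complex.continuous_ofReal.comp_aestronglyMeasurable hf.1).mul (by fun_prop)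
    · filter_upwards [eventually_ge_atTop 0] with t ht
      refine ae_of_all _ fun α => ?_
      by_cases hα : α ∈ Ioc 0 b
      · rw [norm_mul, Complex.norm_real, Complex.norm_exp]
        refine mul_le_of_le_one_right (norm_nonneg _) (Real.exp_le_one_iff.2 ?_)
        have h2 : 0 ≤ b - α := sub_nonneg.2 hα.2
        simp [Complex.mul_re]
        positivity
      · simp [hf0 α hα]
    · have hae : ∀ᵐ α : ℝ, α ≠ b := by
        simp [ae_iff, measure_singleton]
      filter_upwards [hae] with α hne
      by_cases hα : α ∈ Ioc 0 b
      · have h2 : 0 < b - α := sub_pos.2 (lt_of_le_of_ne hα.2 hne)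
        rw [← mul_zero (f α : ℂ)]
        refine Tendsto.const_mul _ (tendsto_zero_iff_norm_tendsto_zero.2 ?_)
        have e : (fun t : ℝ => ‖Complex.exp (2 * (b - α) * (-t : ℂ))‖) =
            fun t => Real.exp (-((2 * (b - α)) * t)) := by
          funext t
          rw [Complex.norm_exp]
          simp [Complex.mul_re]
        rw [e]
        exact Real.tendsto_exp_neg_atTop_nhds_zero.comp
          (tendsto_id.const_mul_atTop (by positivity))
      · simp [hf0 α hα]
  simp_rw [hconst (-_)] at hlim
  have hG0 : G 0 = 0 := by
    rw [integral_zero] at hlim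
    exact tendsto_nhds_unique tendsto_const_nhds hlim
  have := (hconst κ).trans hG0
  exact (mul_eq_zero.1 this).resolve_left (Complex.exp_ne_zero _)

lemma intervalIntegral_eq_laplace {f : ℝ → ℝ} {a : ℝ} (ha : 0 ≤ a) (κ : ℂ) :
    ∫ α in (0 : ℝ)..a, (f α : ℂ) * Complex.exp (-2 * (α : ℂ) * κ) =
      laplace ((Ioc 0 a).indicator f) κ := by
  rw [intervalIntegral.integral_of_le ha, ← integral_indicator measurableSet_Ioc, laplace]
  congr 1
  funext α
  by_cases h : α ∈ Ioc 0 a <;> simp [h]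

lemma laplace_add {f g : ℝ → ℝ} {κ : ℂ}
    (hf : Integrable fun α : ℝ => (f α : ℂ) * Complex.exp (-2 * (α : ℂ) * κ))
    (hg : Integrable fun α : ℝ => (g α : ℂ) * Complex.exp (-2 * (α : ℂ) * κ)) :
    laplace (fun α => f α + g α) κ = laplace f κ + laplace g κ := by
  rw [laplace, laplace, laplace, ← integral_add hf hg]
  congr 1
  funext α
  push_cast
  ring

lemma tendsto_ray_sectorAtInfinity :
    Tendsto (fun r : ℝ => (r : ℂ) * (1 - Complex.I)) atTop (sectorAtInfinity (Real.pi / 8)) := by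
  have hpi := Real.pi_pos
  refine tendsto_inf.2 ⟨?_, tendsto_principal.2 ?_⟩
  · rw [← tendsto_norm_atTop_iff_cobounded]
    have h0 : 0 < ‖1 - Complex.I‖ := by
      rw [norm_pos_iff]
      intro h
      simpa using congrArg Complex.re h
    refine ((tendsto_id.atTop_mul_const h0)).congr' ?_
    filter_upwards [eventually_ge_atTop 0] with r hr
    rw [norm_mul, Complex.norm_real, Real.norm_of_nonneg hr, id]
  · filter_upwards [eventually_gt_atTop 0] with r hr
    have e : (r : ℂ) * (1 - Complex.I) = ((r * Real.sqrt 2 : ℝ) : ℂ) *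
        (Complex.cos ((-(Real.pi / 4) : ℝ) : ℂ) +
          Complex.sin ((-(Real.pi / 4) : ℝ) : ℂ) * Complex.I) := by
      have h2 : Real.sqrt 2 * Real.sqrt 2 = 2 := Real.mul_self_sqrt (by norm_num)
      rw [← Complex.ofReal_cos, ← Complex.ofReal_sin, Real.cos_neg, Real.sin_neg,
        Real.cos_pi_div_four, Real.sin_pi_div_four]
      apply Complex.ext <;> simp <;> linear_combination (-r / 2) * h2
    have harg : ((r : ℂ) * (1 - Complex.I)).arg = -(Real.pi / 4) := by
      rw [e]
      exact Complex.arg_mul_cos_add_sin_mul_I (by positivity) ⟨by linarith, by linarith⟩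
    rw [harg]
    constructor <;> linarith

/-- In the sector `|arg κ| < π/2 - ε`, so `Re κ ≥ |κ| sin ε`. For `ε ≥ π/2` the sector is empty and
the filter is `⊥`. -/
lemma tendsto_re_sectorAtInfinity {ε : ℝ} (hε : 0 < ε) :
    Tendsto Complex.re (sectorAtInfinity ε) atTop := by
  rcases lt_or_ge ε (Real.pi / 2) with h | h
  · have hs : 0 < Real.sin ε := Real.sin_pos_of_pos_of_lt_pi hε (by linarith [Real.pi_pos])
    have h1 : Tendsto (fun κ : ℂ => ‖κ‖ * Real.sin ε) (sectorAtInfinity ε) atTop :=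
      (tendsto_norm_cobounded_atTop.mono_left inf_le_left).atTop_mul_const hs
    refine tendsto_atTop_mono' _ ?_ h1
    refine mem_inf_of_right (mem_principal.2 fun κ hκ => ?_)
    obtain ⟨ha, hb⟩ := hκ
    dsimp only [mem_ofPred_eq]
    rw [← Complex.norm_mul_cos_arg κ, ← Real.cos_pi_div_two_sub, ← Real.cos_abs κ.arg]
    gcongr
    refine Real.cos_le_cos_of_nonneg_of_le_pi (abs_nonneg _) (by linarith) ?_
    rw [abs_le]
    constructor <;> linarith
  · have : {κ : ℂ | -(Real.pi / 2) + ε < κ.arg ∧ κ.arg < -ε} = ∅ := by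
      ext κ
      simp only [mem_ofPred_eq, mem_empty_iff_false, iff_false, not_and, not_lt]
      intro h1
      linarith [Real.pi_pos]
    rw [sectorAtInfinity, this, principal_empty, inf_bot_eq]
    exact tendsto_bot

/-- The `A`-amplitude is determined almost everywhere. -/
lemma IsAAmplitude.ae_eq {q A A' : ℝ → ℝ} (hA : IsAAmplitude q A) (hA' : IsAAmplitude q A') :
    A =ᵐ[volume.restrict (Ioi 0)] A' := by
  have key : ∀ b : ℝ, 0 < b → ∀ᵐ α, α ∈ Ioc 0 b → A α = A' α := by
    intro b hb
    set f : ℝ → ℝ := fun α => A α - A' α with hf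
    have hi : ∀ B : ℝ → ℝ, IsAAmplitude q B → IntegrableOn B (Ioc 0 (2 * b)) := fun B hB =>
      (integrableOn_Ioc_iff_integrableOn_Ioo).2 (hB.integrable (2 * b) (by positivity))
    have hfi : IntegrableOn f (Ioc 0 (2 * b)) := (hi A hA).sub (hi A' hA')
    set f₁ := (Ioc 0 b).indicator f with hf₁
    set f₂ := (Ioc b (2 * b)).indicator f with hf₂
    have hf₁i : Integrable f₁ :=
      (hfi.mono_set (Ioc_subset_Ioc_right (by linarith))).integrable_indicator measurableSet_Ioc
    have hf₂i : Integrable f₂ :=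
      (hfi.mono_set (Ioc_subset_Ioc_left hb.le)).integrable_indicator measurableSet_Ioc
    have hf₂0 : ∀ α ≤ b, f₂ α = 0 := fun α hα =>
      indicator_of_notMem (fun h => (not_lt.2 hα) h.1) _
    -- Using the asymptotics up to `2b` pays for the loss in `Õ`: with exponent `1/2` they bound the
    -- transform over `(0, 2b]` by `|e^{-4bκ}|^{1/2} = e^{-2b Re κ}`. The part over `(b, 2b]` is
    -- itself of this size, so the part over `(0, b]` is too.
    have hO := (hA.asymptotics (2 * b) (by positivity) (Real.pi / 8) (by positivity)).2 (1 / 2)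
      (by norm_num)
    have hO' := (hA'.asymptotics (2 * b) (by positivity) (Real.pi / 8) (by positivity)).2 (1 / 2)
      (by norm_num)
    have hT := ((hO.sub hO').comp tendsto_ray_sectorAtInfinity).norm
    rw [sub_zero, norm_zero] at hT
    obtain ⟨r₀, hr₀⟩ := eventually_atTop.1 ((hT.eventually_le_const zero_lt_one).and
      (eventually_ge_atTop 0))
    have hbound : ∀ r : ℝ, r₀ ≤ r → ‖laplace f₁ (r * (1 - Complex.I))‖ ≤
        (1 + ∫ α, ‖f₂ α‖) * Real.exp (-2 * b * r) := by
      intro r hr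
      obtain ⟨h1, h0⟩ := hr₀ r hr
      set κ : ℂ := r * (1 - Complex.I) with hκ
      have hre : κ.re = r := by simp [hκ]
      have hint : ∀ g : ℝ → ℝ, IntegrableOn g (Ioc 0 (2 * b)) → IntervalIntegrable
          (fun α : ℝ => (g α : ℂ) * Complex.exp (-2 * (α : ℂ) * κ)) volume 0 (2 * b) := by
        intro g hg
        have : IntervalIntegrable (fun α => (g α : ℂ)) volume 0 (2 * b) :=
          (intervalIntegrable_iff_integrableOn_Ioc_of_le (by positivity)).2 hg.ofReal
        exact this.mul_continuousOn (by fun_prop)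
      have hsum : laplace f₁ κ + laplace f₂ κ = (∫ α in (0 : ℝ)..2 * b,
          (A α : ℂ) * Complex.exp (-2 * (α : ℂ) * κ)) - ∫ α in (0 : ℝ)..2 * b,
          (A' α : ℂ) * Complex.exp (-2 * (α : ℂ) * κ) := by
        rw [← intervalIntegral.integral_sub (hint A (hi A hA)) (hint A' (hi A' hA'))]
        have hl : ∀ g : ℝ → ℝ, Integrable g → (∀ α < 0, g α = 0) →
            Integrable fun α : ℝ => (g α : ℂ) * Complex.exp (-2 * (α : ℂ) * κ) := fun g hg hg0 =>
          integrable_laplaceIntegrand (c := 0) hg0 hg.1 (by simpa using hg) (by rw [hre]; exact h0)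
        rw [← laplace_add (hl f₁ hf₁i fun α hα => indicator_of_notMem (fun h => hα.not_gt h.1) _)
          (hl f₂ hf₂i fun α hα => hf₂0 α (hα.le.trans hb.le))]
        have e : (fun α => f₁ α + f₂ α) = (Ioc 0 (2 * b)).indicator f := by
          rw [← Ioc_union_Ioc_eq_Ioc hb.le (by linarith : b ≤ 2 * b),
            indicator_union_of_disjoint (Ioc_disjoint_Ioc_of_le le_rfl)]
        rw [e, ← intervalIntegral_eq_laplace (by positivity)]
        refine intervalIntegral.integral_congr fun α _ => ?_
        simp only [hf]
        push_cast
        ring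
      have h2 : ‖laplace f₂ κ‖ ≤ Real.exp (-2 * b * r) * ∫ α, ‖f₂ α‖ := by
        have := norm_laplace_tail_le (c := 0) hf₂0 (by simpa using hf₂i)
          (κ := κ) (by rw [hre]; exact h0)
        simpa [hre] using this
      have h3 : ‖laplace f₁ κ + laplace f₂ κ‖ ≤ Real.exp (-2 * b * r) := by
        simp only [Function.comp_apply] at h1
        rw [← hκ, ← sub_mul, ← sub_div, norm_mul, norm_div, Complex.norm_real,
          norm_cexp_neg_two, hre] at h1
        have e : weylM q (-κ ^ 2) - (-κ - ∫ α in (0 : ℝ)..2 * b,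
            (A α : ℂ) * Complex.exp (-2 * (α : ℂ) * κ)) - (weylM q (-κ ^ 2) - (-κ -
            ∫ α in (0 : ℝ)..2 * b, (A' α : ℂ) * Complex.exp (-2 * (α : ℂ) * κ))) =
            laplace f₁ κ + laplace f₂ κ := by rw [hsum]; ring
        rw [e, ← Real.exp_mul, Real.norm_of_nonneg (Real.exp_nonneg _), div_mul_eq_mul_div,
          div_le_one (Real.exp_pos _)] at h1
        have e2 : Real.exp (-2 * (2 * b) * r) =
            Real.exp (-2 * b * r) * Real.exp (-2 * (2 * b) * r * (1 / 2)) := by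
          rw [← Real.exp_add]; ring_nf
        rw [e2] at h1
        exact le_of_mul_le_mul_right h1 (Real.exp_pos _)
      have h4 : ‖laplace f₁ κ‖ ≤ ‖laplace f₁ κ + laplace f₂ κ‖ + ‖laplace f₂ κ‖ := by
        simpa using norm_sub_le (laplace f₁ κ + laplace f₂ κ) (laplace f₂ κ)
      linarith
    have hz := ae_eq_zero_of_laplace_eq_zero hf₁i
      (laplace_eq_zero_of_bound hf₁i (fun α hα => indicator_of_notMem hα _) hbound)
    filter_upwards [hz] with α hα hmem
    rw [hf₁, indicator_of_mem hmem] at hα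
    exact sub_eq_zero.1 hα
  rw [EventuallyEq, ae_restrict_iff' measurableSet_Ioi]
  have hall := ae_all_iff.2 fun n : ℕ => key (n + 1) (by positivity)
  filter_upwards [hall] with α hα hpos
  obtain ⟨n, hn⟩ := exists_nat_ge α
  exact hα n ⟨hpos, by linarith⟩

/-! ### The Weyl–Titchmarsh function and its amplitude -/

/-- The construction needs a potential measurable and bounded at every real point. A measurable
representative clipped to `[-Q, Q]` provides one without enlarging the bound, and Weyl solutions see
only the almost everywhere class on `(0, ∞)`. -/
lemma exists_measurable_bounded_ae_eq {q : ℝ → ℝ}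
    (hq : MemLp q ⊤ (volume.restrict (Ioi (0 : ℝ)))) :
    ∃ p : ℝ → ℝ, Measurable p ∧
      (∀ x, |p x| ≤ (eLpNorm q ⊤ (volume.restrict (Ioi (0 : ℝ)))).toReal) ∧
      q =ᵐ[volume.restrict (Ioi 0)] p := by
  set Q := (eLpNorm q ⊤ (volume.restrict (Ioi (0 : ℝ)))).toReal
  have hQ : 0 ≤ Q := ENNReal.toReal_nonneg
  refine ⟨fun x => max (-Q) (min Q (hq.1.aemeasurable.mk q x)), ?_, fun x => ?_, ?_⟩
  · exact measurable_const.max (measurable_const.min hq.1.aemeasurable.measurable_mk)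
  · exact abs_le.2 ⟨le_max_left _ _, max_le (by linarith) (min_le_left _ _)⟩
  · have hb : ∀ᵐ x ∂volume.restrict (Ioi (0 : ℝ)), ‖q x‖ₑ ≤
        eLpNorm q ⊤ (volume.restrict (Ioi (0 : ℝ))) := by
      rw [eLpNorm_exponent_top]
      exact enorm_ae_le_eLpNormEssSup q _
    filter_upwards [hb, hq.1.aemeasurable.ae_eq_mk] with x hx hmk
    have h1 : |q x| ≤ Q := by
      rw [← Real.norm_eq_abs, ← toReal_enorm]
      exact ENNReal.toReal_mono hq.2.ne hx
    rw [← hmk, min_eq_right (abs_le.1 h1).2, max_eq_right (abs_le.1 h1).1]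

section

variable {q p : ℝ → ℝ} {Q : ℝ} {κ : ℂ}

lemma weylM_eq (hp : Measurable p) (hQ : ∀ x, |p x| ≤ Q)
    (hqp : q =ᵐ[volume.restrict (Ioi 0)] p) (hκ : 0 < κ.re) (h : Q < κ.re ^ 2) :
    weylM q (-κ ^ 2) = -κ - laplace (fun α => amp p α 0) κ := by
  have hex : ∃ w : (ℝ → ℂ) × (ℝ → ℂ), IsWeylSolution q (-κ ^ 2) w.1 w.2 :=
    ⟨(_, _), (isWeylSolution_weylSol hp hQ hκ h).congr hqp.symm⟩
  rw [weylM, dif_pos hex]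
  exact (IsWeylSolution.quotient_eq hp hQ hκ h (hex.choose_spec.congr hqp)).2

lemma integrable_amp_mul_exp (hp : Measurable p) (hQ : ∀ x, |p x| ≤ Q) {c : ℝ} (hc : 0 < c)
    (h : Q < c ^ 2) : Integrable fun α => amp p α 0 * Real.exp (-2 * α * c) := by
  have := (integrable_amp_mul_cexp (κ := c) hp hQ (by simpa) (by simpa) 0).re
  refine this.congr (ae_of_all _ fun α => ?_)
  have e : (amp p α 0 : ℂ) * Complex.exp (-2 * (α : ℂ) * c) =
      ((amp p α 0 * Real.exp (-2 * α * c) : ℝ) : ℂ) := by push_cast; rfl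
  beta_reduce
  rw [e]
  exact Complex.ofReal_re _

lemma isAAmplitude_amp (hp : Measurable p) (hQ : ∀ x, |p x| ≤ Q)
    (hqp : q =ᵐ[volume.restrict (Ioi 0)] p) : IsAAmplitude q fun α => amp p α 0 where
  integrable a ha := by
    have hQ0 : 0 ≤ Q := (abs_nonneg _).trans (hQ 0)
    have h := integrable_amp_mul_exp hp hQ (c := Q + 1) (by positivity) (by nlinarith)
    have h1 : IntegrableOn (fun α => amp p α 0 * Real.exp (-2 * α * (Q + 1)) *
        Real.exp (2 * α * (Q + 1))) (Icc 0 a) :=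
      h.integrableOn.mul_continuousOn (by fun_prop) isCompact_Icc
    refine (h1.mono_set Ioo_subset_Icc_self).congr_fun (fun α _ => ?_) measurableSet_Ioo
    beta_reduce
    rw [mul_assoc, ← Real.exp_add]
    ring_nf
    simp
  asymptotics a ha ε hε := by
    have hQ0 : 0 ≤ Q := (abs_nonneg _).trans (hQ 0)
    have hre := tendsto_re_sectorAtInfinity hε
    have hnorm : Tendsto (fun κ : ℂ => ‖Complex.exp (-2 * (a : ℂ) * κ)‖) (sectorAtInfinity ε)
        (𝓝 0) := by
      simp_rw [norm_cexp_neg_two]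
      have : Tendsto (fun κ : ℂ => 2 * a * κ.re) (sectorAtInfinity ε) atTop :=
        hre.const_mul_atTop (by positivity)
      refine (Real.tendsto_exp_neg_atTop_nhds_zero.comp this).congr fun κ => ?_
      simp only [Function.comp_apply]
      ring_nf
    refine ⟨tendsto_zero_iff_norm_tendsto_zero.2 hnorm, fun δ hδ => ?_⟩
    have hpow : Tendsto (fun κ : ℂ => ‖Complex.exp (-2 * (a : ℂ) * κ)‖ ^ δ) (sectorAtInfinity ε)
        (𝓝 0) := by
      simpa [Real.zero_rpow hδ.ne'] using hnorm.rpow_const (Or.inr hδ.le)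
    set c := Q + 1 with hc
    have hc0 : 0 < c := by positivity
    have hcQ : Q < c ^ 2 := by nlinarith
    have hint := integrable_amp_mul_exp hp hQ hc0 hcQ
    set t : ℝ → ℝ := (Ioi a).indicator fun α => amp p α 0 with ht
    set s : ℝ → ℝ := (Ioc 0 a).indicator fun α => amp p α 0 with hs
    have hind : ∀ S : Set ℝ, MeasurableSet S →
        Integrable fun α => S.indicator (fun α => amp p α 0) α * Real.exp (-2 * α * c) := by
      intro S hS
      refine (hint.indicator hS).congr (ae_of_all _ fun α => ?_)
      by_cases h : α ∈ S <;> simp [h]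
    have hst : (fun α => amp p α 0) = fun α => s α + t α := by
      funext α
      simp only [hs, ht]
      rcases le_or_gt α 0 with h0 | h0
      · have h1 : α ∉ Ioi a := fun h => (h0.trans ha.le).not_gt h
        have h2 : α ∉ Ioc 0 a := fun h => h0.not_gt h.1
        simp [h1, h2, amp_of_nonpos p h0]
      · rcases le_or_gt α a with h1 | h1
        · simp [h0, h1, not_lt.2 h1]
        · simp [h1, not_le.2 h1]
    set K := ∫ α, ‖t α * Real.exp (-2 * α * c)‖ with hK
    refine squeeze_zero_norm' (a := fun κ : ℂ =>
      Real.exp (2 * a * c) * K * ‖Complex.exp (-2 * (a : ℂ) * κ)‖ ^ δ) ?_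
      (by simpa using hpow.const_mul (Real.exp (2 * a * c) * K))
    filter_upwards [hre.eventually_ge_atTop c] with κ hκ
    have hκ0 : 0 < κ.re := hc0.trans_le hκ
    have hκQ : Q < κ.re ^ 2 := hcQ.trans_le (by gcongr)
    have hmeas := (measurable_amp hp 0)
    have hsplit : laplace (fun α => amp p α 0) κ = laplace s κ + laplace t κ := by
      have hl : ∀ S : Set ℝ, MeasurableSet S → Integrable fun α : ℝ =>
          ((S.indicator (fun α => amp p α 0) α : ℝ) : ℂ) * Complex.exp (-2 * (α : ℂ) * κ) := by
        intro S hS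
        refine integrable_laplaceIntegrand (fun α hα => ?_)
          (hmeas.indicator hS).aestronglyMeasurable (hind S hS) hκ
        by_cases h : α ∈ S <;> simp [h, amp_of_nonpos p hα.le]
      conv_lhs => rw [hst]
      exact laplace_add (hl _ measurableSet_Ioc) (hl _ measurableSet_Ioi)
    -- By the exact formula the error is precisely the Laplace tail over `(a, ∞)`, which is even
    -- `O(e^{-2aκ})`; any positive power of `|e^{-2aκ}|` then makes it vanish.
    have hdiff : weylM q (-κ ^ 2) - (-κ - ∫ α in (0 : ℝ)..a,
        ((amp p α 0 : ℝ) : ℂ) * Complex.exp (-2 * (α : ℂ) * κ)) = -laplace t κ := by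
      rw [weylM_eq hp hQ hqp hκ0 hκQ, intervalIntegral_eq_laplace ha.le, hsplit]
      ring
    have htail := norm_laplace_tail_le (f := t) (a := a) (c := c) (κ := κ)
      (fun α hα => indicator_of_notMem (fun h => hα.not_gt h) _) (hind _ measurableSet_Ioi) hκ
    rw [hdiff, norm_mul, norm_div, norm_neg, Complex.norm_real,
      Real.norm_of_nonneg (Real.rpow_nonneg (norm_nonneg _) _)]
    gcongr
    rw [div_le_iff₀ (norm_pos_iff.2 (Complex.exp_ne_zero _)), norm_cexp_neg_two]
    refine htail.trans (le_of_eq ?_)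
    have : Real.exp (-2 * a * (κ.re - c)) =
        Real.exp (2 * a * c) * Real.exp (-2 * a * κ.re) := by
      rw [← Real.exp_add]; ring_nf
    rw [this]
    ring

lemma analyticAt_weylM (hp : Measurable p) (hQ : ∀ x, |p x| ≤ Q)
    (hqp : q =ᵐ[volume.restrict (Ioi 0)] p) {k : ℝ} (hk : 0 < k) (h : Q < k ^ 2) :
    AnalyticAt ℂ (weylM q) (-(k : ℂ) ^ 2) := by
  have hQ0 : 0 ≤ Q := (abs_nonneg _).trans (hQ 0)
  set b := Real.sqrt Q with hb
  have hb0 : 0 ≤ b := Real.sqrt_nonneg Q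
  have hbQ : b ^ 2 = Q := Real.sq_sqrt hQ0
  have hbk : b < k := by nlinarith
  have hneg : ∀ α < 0, amp p α 0 = 0 := fun α hα => amp_of_nonpos p hα.le 0
  have hL : AnalyticOnNhd ℂ (laplace fun α => amp p α 0) {κ : ℂ | b < κ.re} := by
    refine DifferentiableOn.analyticOnNhd (fun κ hκ => ?_)
      (isOpen_lt continuous_const Complex.continuous_re)
    have hκ' : b < κ.re := hκ
    exact (differentiableAt_laplace (c := (b + κ.re) / 2) hneg
      (measurable_amp hp 0).aestronglyMeasurable
      (integrable_amp_mul_exp hp hQ (by linarith) (by nlinarith))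
      (by linarith)).differentiableWithinAt
  -- The principal root inverts `κ ↦ -κ²` near the point and keeps `Re r(z) > √Q` there, where the
  -- Laplace formula for `weylM` is valid.
  set r : ℂ → ℂ := fun z => (-z) ^ (1 / 2 : ℂ) with hr
  have hr0 : r (-(k : ℂ) ^ 2) = k := by
    simp only [hr, neg_neg]
    rw [← Complex.ofReal_pow, show (1 / 2 : ℂ) = ((1 / 2 : ℝ) : ℂ) by push_cast; rfl,
      ← Complex.ofReal_cpow (by positivity), ← Real.sqrt_eq_rpow, Real.sqrt_sq hk.le]
  have hra : AnalyticAt ℂ r (-(k : ℂ) ^ 2) := by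
    refine analyticAt_id.neg.cpow analyticAt_const ?_
    simp only [Pi.neg_apply, id, neg_neg]
    rw [← Complex.ofReal_pow]
    exact Complex.ofReal_mem_slitPlane.2 (by positivity)
  have hcomp : AnalyticAt ℂ (fun z => -r z - laplace (fun α => amp p α 0) (r z))
      (-(k : ℂ) ^ 2) := by
    refine hra.neg.sub (AnalyticAt.fun_comp ?_ hra)
    rw [hr0]
    exact hL _ (by simpa using hbk)
  refine hcomp.congr ?_
  have hev : ∀ᶠ z in 𝓝 (-(k : ℂ) ^ 2), b < (r z).re :=
    (Complex.continuous_re.continuousAt.comp hra.continuousAt).eventually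
      (lt_mem_nhds (by simpa [hr0] using hbk))
  filter_upwards [hev] with z hz
  have hsq : -r z ^ 2 = z := by
    simp only [hr]
    rw [← Complex.cpow_nat_mul]
    simp
  have := weylM_eq (κ := r z) hp hQ hqp (hb0.trans_lt hz) (by nlinarith)
  rw [hsq] at this
  exact this.symm

end

end Schrodinger

end

theorem theorem10p3 (q : ℝ → ℝ) (hq : MemLp q ⊤ (volume.restrict (Ioi (0 : ℝ)))) :
    (∃ A : ℝ → ℝ, Schrodinger.IsAAmplitude q A) ∧
    ∀ A : ℝ → ℝ, Schrodinger.IsAAmplitude q A →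
      ∀ κ : ℝ, 0 < κ → (eLpNorm q ⊤ (volume.restrict (Ioi (0 : ℝ)))).toReal < κ ^ 2 →
        -- the value of m at the real point -κ² is well defined by the Weyl solutions there
        (∃ u u' : ℝ → ℂ, Schrodinger.IsWeylSolution q (-(κ : ℂ) ^ 2) u u') ∧
        (∀ u u' : ℝ → ℂ, Schrodinger.IsWeylSolution q (-(κ : ℂ) ^ 2) u u' →
          u 0 ≠ 0 ∧ u' 0 / u 0 = Schrodinger.weylM q (-(κ : ℂ) ^ 2)) ∧
        -- and is the analytic continuation of m from the upper half plane
        AnalyticAt ℂ (Schrodinger.weylM q) (-(κ : ℂ) ^ 2) ∧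
        -- the integral converges and there is no error term
        IntegrableOn (fun α : ℝ => A α * Real.exp (-2 * α * κ)) (Ioi 0) ∧
        Schrodinger.weylM q (-(κ : ℂ) ^ 2) =
          ((-κ - ∫ α in Ioi (0 : ℝ), A α * Real.exp (-2 * α * κ) : ℝ) : ℂ) := by
  open Schrodinger in
  obtain ⟨p, hp, hQ, hqp⟩ := exists_measurable_bounded_ae_eq hq
  refine ⟨⟨_, isAAmplitude_amp hp hQ hqp⟩, fun A hA κ hκ hQκ => ?_⟩
  have hκ' : 0 < (κ : ℂ).re := by simpa
  have hQκ' : (eLpNorm q ⊤ (volume.restrict (Ioi (0 : ℝ)))).toReal < (κ : ℂ).re ^ 2 := by simpa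
  have hm := weylM_eq hp hQ hqp hκ' hQκ'
  -- Uniqueness carries both the convergence and the formula from the constructed amplitude to an
  -- arbitrary one.
  have hAe := hA.ae_eq (isAAmplitude_amp hp hQ hqp)
  have hAe' : (fun α => A α * Real.exp (-2 * α * κ)) =ᵐ[volume.restrict (Ioi 0)]
      fun α => amp p α 0 * Real.exp (-2 * α * κ) := by
    filter_upwards [hAe] with α hα
    rw [hα]
  refine ⟨⟨_, _, (isWeylSolution_weylSol hp hQ hκ' hQκ').congr hqp.symm⟩, fun u u' hu => ?_,
    analyticAt_weylM hp hQ hqp hκ hQκ,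
    (integrable_amp_mul_exp hp hQ hκ hQκ).integrableOn.congr hAe'.symm, ?_⟩
  · rw [hm]
    exact IsWeylSolution.quotient_eq hp hQ hκ' hQκ' (hu.congr hqp)
  · rw [hm, integral_congr_ae hAe']
    have e : laplace (fun α => amp p α 0) κ =
        ((∫ α in Ioi (0 : ℝ), amp p α 0 * Real.exp (-2 * α * κ) : ℝ) : ℂ) := by
      rw [setIntegral_eq_integral_of_forall_compl_eq_zero fun α hα => by
        rw [amp_of_nonpos p (not_lt.1 hα), zero_mul], ← integral_complex_ofReal, laplace]
      congr 1
      funext α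
      push_cast
      rfl
    rw [e]
    push_cast
    rfl
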